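/- Let $\mathbb{F}$ be a field of characteristic $0$ and let $K$ be a finite group. For a finite group $G$ let $\mathbb{F}B(G)=\mathbb{F}\otimes_{\mathbb{Z}}B(G)$, where $B(G)$ is the Burnside group of $G$, i.e. the Grothendieck group of finite $G$-sets under disjoint union. The shifted Burnside functor $\mathbb{F}B_K$ has evaluations $\mathbb{F}B_K(G)=\mathbb{F}B(G\times K)$. For finite groups $G,H$, a finite $(H,G)$-biset $U$ acts by $\mathbb{F}B_K(U):\mathbb{F}B_K(G)\to\mathbb{F}B_K(H)$, $[X]\mapsto[(U\times K)\times_{G\times K}X]$, where $K$ acts on both sides of $U\times K$ by multiplication on the second component. The product $\mathbb{F}B_K(G)\times\mathbb{F}B_K(H)\to\mathbb{F}B_K(G\times H)$ is the bilinear map sending $([X],[Y])$ to the class of $X\times Y$, on which $(g,h,k)$ acts by $(x,y)\mapsto((g,k)x,(h,k)y)$. An ideal $I$ of $\mathbb{F}B_K$ is a family of subspaces $I(G)\subseteq\mathbb{F}B_K(G)$, for all finite groups $G$, stable under the action of all finite bisets and such that $\alpha\in\mathbb{F}B_K(G)$, $\beta\in I(H)$ imply that the product of $\alpha$ and $\beta$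 lies in $I(G\times H)$; ideals are ordered by inclusion of all their evaluations. For a subgroup $X$ of a finite group $\Gamma$, let $$e_X^{\Gamma}=\frac{1}{|N_{\Gamma}(X)|}\sum_{Y\le X}|Y|\,\mu(Y,X)\,[\Gamma/Y]\in\mathbb{F}B(\Gamma),$$ where $\mu$ is the Möbius function of the poset of subgroups of $\Gamma$. For a normal subgroup $N$ of a finite group $L$, let $$m_{L,N}=\frac{1}{|L|}\sum_{Y\le L,\;YN=L}|Y|\,\mu(Y,L).$$ A group over $K$ is a pair $(L,\varphi)$, where $L$ is a finite group and $\varphi:L\to K$ is a group homomorphism. For groups $(M,\psi)$ and $(L,\varphi)$ over $K$, write $(M,\psi)\twoheadrightarrow(L,\varphi)$ if there are a surjective group homomorphism $f:M\to L$ and an inner automorphism $i$ of $K$ with $i\circ\psi=\varphi\circ f$. The group $(L,\varphi)$ over $K$ is called a $B_K$-group if $m_{L,N}=0$ for every non-trivial normal subgroup $N$ of $L$ contained in $\mathrm{Ker}\,\varphi$. Let $L_\varphi=\{(l,\varphi(l))\mid l\in L\}\le L\times K$, and let $\mathsf{e}_{L,\varphi}$ be the ideal of $\mathbb{F}B_K$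 generated by $e_{L_\varphi}^{L\times K}\in\mathbb{F}B_K(L)$. **Theorem.** Let $(L,\varphi)$ be a $B_K$-group. 1. For every finite group $G$, $$\mathsf{e}_{L,\varphi}(G)=\sum_{X}\mathbb{F}\,e_X^{G\times K},$$ where $X$ runs through all subgroups of $G\times K$ such that $(X,p_2)\twoheadrightarrow(L,\varphi)$, and $p_2:X\to K$ is the restriction to $X$ of the second projection $G\times K\to K$. 2. For every group $(M,\psi)$ over $K$, $\mathsf{e}_{M,\psi}\subseteq\mathsf{e}_{L,\varphi}$ if and only if $(M,\psi)\twoheadrightarrow(L,\varphi)$. -/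

import Mathlib

open scoped TensorProduct

universe u v

/-! ## Finite `G`-sets and the Burnside group -/

/-- A finite (left) `G`-set. -/
structure FinGSet (G : Type u) [Group G] where
  carrier : Type u
  [action : MulAction G carrier]
  [finite : Finite carrier]

attribute [instance] FinGSet.action FinGSet.finite

namespace FinGSet

variable {G H P Q : Type u} [Group G] [Group H] [Group P] [Group Q]

/-- Two finite `G`-sets are isomorphic if there is a `G`-equivariant bijection between them. -/
def Iso (X Y : FinGSet G) : Prop :=
  ∃ f : X.carrier ≃ Y.carrier, ∀ (g : G) (x : X.carrier), f (g • x) = g • f x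

theorem Iso.refl (X : FinGSet G) : Iso X X := ⟨Equiv.refl _, fun _ _ => rfl⟩

theorem Iso.symm {X Y : FinGSet G} : Iso X Y → Iso Y X := by
  rintro ⟨f, hf⟩
  exact ⟨f.symm, fun g y => by rw [Equiv.symm_apply_eq, hf, Equiv.apply_symm_apply]⟩

theorem Iso.trans {X Y Z : FinGSet G} : Iso X Y → Iso Y Z → Iso X Z := by
  rintro ⟨f, hf⟩ ⟨f', hf'⟩
  exact ⟨f.trans f', fun g x => by simp [hf, hf']⟩

instance setoid (G : Type u) [Group G] : Setoid (FinGSet G) where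
  r := Iso
  iseqv := ⟨Iso.refl, Iso.symm, Iso.trans⟩

/-- The disjoint union of two finite `G`-sets. -/
def sum (X Y : FinGSet G) : FinGSet G where
  carrier := X.carrier ⊕ Y.carrier

/-- The empty `G`-set. -/
def empty (G : Type u) [Group G] : FinGSet G where
  carrier := PEmpty
  action :=
    { smul := fun _ x => x
      one_smul := fun x => x.elim
      mul_smul := fun _ _ x => x.elim }

/-- The transitive `G`-set `G / X`. -/
def coset [Finite G] (X : Subgroup G) : FinGSet G where
  carrier := G ⧸ X

/-- The cartesian product of a `G`-set and an `H`-set, as a `(G × H)`-set. -/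
def prod (X : FinGSet G) (Y : FinGSet H) : FinGSet (G × H) where
  carrier := X.carrier × Y.carrier
  action :=
    { smul := fun g x => (g.1 • x.1, g.2 • x.2)
      one_smul := fun x => Prod.ext (one_smul G x.1) (one_smul H x.2)
      mul_smul := fun a b x => Prod.ext (mul_smul a.1 b.1 x.1) (mul_smul a.2 b.2 x.2) }

/-- The `P`-set obtained from a `Q`-set by letting `P` act through a homomorphism `f : P → Q`.
For injective `f` this is restriction to the subgroup `f(P)` followed by transport through the
isomorphism `f(P) ≅ P`. -/
def pullback (f : P →* Q) (X : FinGSet Q) : FinGSet P where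
  carrier := X.carrier
  action := MulAction.compHom X.carrier f

theorem sum_iso {X X' Y Y' : FinGSet G} (h : Iso X X') (h' : Iso Y Y') :
    Iso (sum X Y) (sum X' Y') := by
  obtain ⟨f, hf⟩ := h
  obtain ⟨f', hf'⟩ := h'
  refine ⟨Equiv.sumCongr f f', ?_⟩
  rintro g (x | x)
  · exact congrArg Sum.inl (hf g x)
  · exact congrArg Sum.inr (hf' g x)

theorem sum_comm_iso (X Y : FinGSet G) : Iso (sum X Y) (sum Y X) := by
  refine ⟨Equiv.sumComm _ _, ?_⟩
  rintro g (x | x) <;> rfl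

theorem sum_assoc_iso (X Y Z : FinGSet G) : Iso (sum (sum X Y) Z) (sum X (sum Y Z)) := by
  refine ⟨Equiv.sumAssoc _ _ _, ?_⟩
  rintro g ((x | x) | x) <;> rfl

theorem empty_sum_iso (X : FinGSet G) : Iso (sum (empty G) X) X := by
  refine ⟨Equiv.emptySum PEmpty _, ?_⟩
  rintro g (x | x)
  · exact x.elim
  · rfl

theorem prod_iso {X X' : FinGSet G} {Y Y' : FinGSet H} (h : Iso X X') (h' : Iso Y Y') :
    Iso (prod X Y) (prod X' Y') := by
  obtain ⟨f, hf⟩ := h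
  obtain ⟨f', hf'⟩ := h'
  exact ⟨Equiv.prodCongr f f', fun g x => Prod.ext (hf g.1 x.1) (hf' g.2 x.2)⟩

theorem prod_empty_iso (X : FinGSet G) : Iso (prod X (empty H)) (empty (G × H)) :=
  ⟨Equiv.prodPEmpty _, fun _ x => (x.2 : PEmpty).elim⟩

theorem empty_prod_iso (Y : FinGSet H) : Iso (prod (empty G) Y) (empty (G × H)) :=
  ⟨Equiv.pemptyProd _, fun _ x => (x.1 : PEmpty).elim⟩

theorem prod_sum_iso (X : FinGSet G) (Y Y' : FinGSet H) :
    Iso (prod X (sum Y Y')) (sum (prod X Y) (prod X Y')) := by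
  refine ⟨Equiv.prodSumDistrib _ _ _, ?_⟩
  rintro g ⟨x, y | y⟩ <;> rfl

theorem sum_prod_iso (X X' : FinGSet G) (Y : FinGSet H) :
    Iso (prod (sum X X') Y) (sum (prod X Y) (prod X' Y)) := by
  refine ⟨Equiv.sumProdDistrib _ _ _, ?_⟩
  rintro g ⟨x | x, y⟩ <;> rfl

theorem pullback_iso (f : P →* Q) {X Y : FinGSet Q} (h : Iso X Y) :
    Iso (pullback f X) (pullback f Y) := by
  obtain ⟨e, he⟩ := h
  exact ⟨e, fun g x => he (f g) x⟩

theorem pullback_empty_iso (f : P →* Q) : Iso (pullback f (empty Q)) (empty P) :=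
  ⟨Equiv.refl _, fun _ x => (x : PEmpty).elim⟩

theorem pullback_sum_iso (f : P →* Q) (X Y : FinGSet Q) :
    Iso (pullback f (sum X Y)) (sum (pullback f X) (pullback f Y)) := by
  refine ⟨Equiv.refl _, ?_⟩
  rintro g (x | x) <;> rfl

end FinGSet

/-- The set of isomorphism classes of finite `G`-sets. -/
def GSetClass (G : Type u) [Group G] : Type (u + 1) := Quotient (FinGSet.setoid G)

namespace GSetClass

variable {G H P Q : Type u} [Group G] [Group H] [Group P] [Group Q]

/-- The isomorphism class of a finite `G`-set. -/
def mk (X : FinGSet G) : GSetClass G := Quotient.mk (FinGSet.setoid G) X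

theorem sound {X Y : FinGSet G} (h : X.Iso Y) : mk X = mk Y :=
  Quotient.sound (s := FinGSet.setoid G) h

theorem ind {p : GSetClass G → Prop} (h : ∀ X : FinGSet G, p (mk X)) (x : GSetClass G) : p x :=
  Quotient.ind (s := FinGSet.setoid G) h x

instance : Zero (GSetClass G) := ⟨mk (FinGSet.empty G)⟩

instance : Add (GSetClass G) :=
  ⟨Quotient.map₂ FinGSet.sum fun _ _ h _ _ h' => FinGSet.sum_iso h h'⟩

/-- Disjoint union makes the isomorphism classes of finite `G`-sets a commutative monoid. -/
instance addCommMonoid : AddCommMonoid (GSetClass G) where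
  add_comm := ind fun X => ind fun Y => sound (FinGSet.sum_comm_iso X Y)
  add_assoc := ind fun X => ind fun Y => ind fun Z => sound (FinGSet.sum_assoc_iso X Y Z)
  zero_add := ind fun X => sound (FinGSet.empty_sum_iso X)
  add_zero := ind fun X =>
    sound ((FinGSet.sum_comm_iso X (FinGSet.empty G)).trans (FinGSet.empty_sum_iso X))
  nsmul := nsmulRec

/-- Additive map on isomorphism classes induced by restriction along a homomorphism. -/
def pullback (f : P →* Q) : GSetClass Q →+ GSetClass P where
  toFun := Quotient.map (FinGSet.pullback f) fun _ _ h => FinGSet.pullback_iso f h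
  map_zero' := sound (FinGSet.pullback_empty_iso f)
  map_add' := ind fun X => ind fun Y => sound (FinGSet.pullback_sum_iso f X Y)

/-- The map on isomorphism classes induced by the cartesian product. -/
def prodFun : GSetClass G → GSetClass H → GSetClass (G × H) :=
  Quotient.map₂ FinGSet.prod fun _ _ h _ _ h' => FinGSet.prod_iso h h'

theorem prodFun_zero : ∀ x : GSetClass G, prodFun x (0 : GSetClass H) = 0 :=
  ind fun X => sound (FinGSet.prod_empty_iso X)

theorem zero_prodFun : ∀ y : GSetClass H, prodFun (0 : GSetClass G) y = 0 :=
  ind fun Y => sound (FinGSet.empty_prod_iso Y)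

theorem prodFun_add : ∀ (x : GSetClass G) (y y' : GSetClass H),
    prodFun x (y + y') = prodFun x y + prodFun x y' :=
  ind fun X => ind fun Y => ind fun Y' => sound (FinGSet.prod_sum_iso X Y Y')

theorem add_prodFun : ∀ (x x' : GSetClass G) (y : GSetClass H),
    prodFun (x + x') y = prodFun x y + prodFun x' y :=
  ind fun X => ind fun X' => ind fun Y => sound (FinGSet.sum_prod_iso X X' Y)

/-- `prodFun` as a biadditive map. -/
def prod : GSetClass G →+ GSetClass H →+ GSetClass (G × H) where
  toFun x := ⟨⟨prodFun x, prodFun_zero x⟩, prodFun_add x⟩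
  map_zero' := AddMonoidHom.ext zero_prodFun
  map_add' x x' := AddMonoidHom.ext (add_prodFun x x')

end GSetClass

/-- The Burnside group `B(G)`: the Grothendieck group of finite `G`-sets. -/
abbrev BurnsideGroup (G : Type u) [Group G] : Type (u + 1) :=
  Algebra.GrothendieckAddGroup (GSetClass G)

namespace BurnsideGroup

variable {G H P Q : Type u} [Group G] [Group H] [Group P] [Group Q]

/-- The class of a finite `G`-set in `B(G)`. -/
noncomputable def of : GSetClass G →+ BurnsideGroup G := Algebra.GrothendieckAddGroup.of

theorem hom_ext {A : Type*} [AddCommGroup A] {f g : BurnsideGroup G →+ A}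
    (h : ∀ x : GSetClass G, f (of x) = g (of x)) : f = g :=
  Algebra.GrothendieckAddGroup.lift.symm.injective (AddMonoidHom.ext h)

theorem lift_of {A : Type*} [AddCommGroup A] (f : GSetClass G →+ A) (x : GSetClass G) :
    Algebra.GrothendieckAddGroup.lift f (of x) = f x :=
  DFunLike.congr_fun (Algebra.GrothendieckAddGroup.lift.symm_apply_apply f) x

/-- The map `B(P) → B(Q)` induced by an additive map on isomorphism classes. -/
noncomputable def map (f : GSetClass P →+ GSetClass Q) : BurnsideGroup P →+ BurnsideGroup Q :=
  Algebra.GrothendieckAddGroup.lift (of.comp f)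

theorem map_of (f : GSetClass P →+ GSetClass Q) (x : GSetClass P) : map f (of x) = of (f x) :=
  lift_of _ x

/-- The biadditive map `B(G) × B(H) → B(G × H)` induced by the cartesian product. -/
noncomputable def prod : BurnsideGroup G →+ BurnsideGroup H →+ BurnsideGroup (G × H) :=
  Algebra.GrothendieckAddGroup.lift
    { toFun := fun x => map (GSetClass.prod x)
      map_zero' := hom_ext fun y => by simp [map_of]
      map_add' := fun x x' => hom_ext fun y => by simp [map_of] }

theorem prod_of (x : GSetClass G) (y : GSetClass H) :
    prod (of x) (of y) = of (GSetClass.prod x y) := by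
  rw [prod, lift_of]
  exact map_of _ y

end BurnsideGroup

/-- `𝔽B(G) = 𝔽 ⊗ B(G)`. -/
abbrev FBurnside (F : Type v) [Field F] (G : Type u) [Group G] : Type (max v (u + 1)) :=
  F ⊗[ℤ] BurnsideGroup G

namespace FBurnside

variable (F : Type v) [Field F] {G H P Q : Type u} [Group G] [Group H] [Group P] [Group Q]

/-- The class `[X]` of a finite `G`-set in `𝔽B(G)`. -/
noncomputable def cls (X : FinGSet G) : FBurnside F G :=
  (1 : F) ⊗ₜ[ℤ] BurnsideGroup.of (GSetClass.mk X)

/-- The linear map `𝔽B(P) → 𝔽B(Q)` induced by an additive map on isomorphism classes. -/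
noncomputable def map (f : GSetClass P →+ GSetClass Q) : FBurnside F P →ₗ[F] FBurnside F Q :=
  LinearMap.baseChange F (BurnsideGroup.map f).toIntLinearMap

/-- `𝔽B(Q) → 𝔽B(P)` induced by letting `P` act through `f : P → Q`. -/
noncomputable def pullback (f : P →* Q) : FBurnside F Q →ₗ[F] FBurnside F P :=
  map F (GSetClass.pullback f)

/-- The bilinear map `𝔽B(G) × 𝔽B(H) → 𝔽B(G × H)`, `(α, β) ↦ α × β`, induced by the cartesian
product. -/
noncomputable def prod : FBurnside F G →ₗ[F] FBurnside F H →ₗ[F] FBurnside F (G × H) :=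
  LinearMap.liftBaseChange F
    (AddMonoidHom.toIntLinearMap
      { toFun := fun a => LinearMap.baseChange F (BurnsideGroup.prod a).toIntLinearMap
        map_zero' := by
          ext y
          simp
        map_add' := fun a a' => by
          ext y
          simp [TensorProduct.tmul_add] })

theorem cls_eq_of_iso {X Y : FinGSet G} (h : X.Iso Y) : cls F X = cls F Y := by
  rw [cls, cls, GSetClass.sound h]

theorem cls_sum (X Y : FinGSet G) : cls F (X.sum Y) = cls F X + cls F Y := by
  rw [cls, cls, cls, ← TensorProduct.tmul_add, ← map_add]
  rfl

theorem map_cls (f : GSetClass P →+ GSetClass Q) (X : FinGSet P) :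
    map F f (cls F X) = (1 : F) ⊗ₜ[ℤ] BurnsideGroup.of (f (GSetClass.mk X)) := by
  simp [map, cls, BurnsideGroup.map_of]

theorem pullback_cls (f : P →* Q) (X : FinGSet Q) :
    pullback F f (cls F X) = cls F (X.pullback f) :=
  map_cls F _ X

theorem prod_cls (X : FinGSet G) (Y : FinGSet H) :
    prod F (cls F X) (cls F Y) = cls F (X.prod Y) := by
  simp only [prod, cls, LinearMap.liftBaseChange_tmul, one_smul, AddMonoidHom.coe_toIntLinearMap,
    AddMonoidHom.coe_mk, ZeroHom.coe_mk, LinearMap.baseChange_tmul, BurnsideGroup.prod_of]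
  rfl

end FBurnside

/-! ## Bisets and their action on Burnside groups -/

/-- A finite `(Q, P)`-biset: a finite set with commuting actions of `Q` on the left and of `P` on
the right (a right action of `P` being an action of the opposite group). -/
structure FinBiset (Q P : Type u) [Group Q] [Group P] where
  carrier : Type u
  [leftAction : MulAction Q carrier]
  [rightAction : MulAction Pᵐᵒᵖ carrier]
  [smulComm : SMulCommClass Q Pᵐᵒᵖ carrier]
  [finite : Finite carrier]

attribute [instance] FinBiset.leftAction FinBiset.rightAction FinBiset.smulComm FinBiset.finite

namespace FinBiset

variable {G H P Q : Type u} [Group G] [Group H] [Group P] [Group Q]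

/-- The orbit relation of `P` on `V × X` for the action `(v, x) · p = (v p, p⁻¹ x)`. -/
def tensorSetoid (V : FinBiset Q P) (X : FinGSet P) : Setoid (V.carrier × X.carrier) where
  r a b := ∃ p : P, b = (MulOpposite.op p • a.1, p⁻¹ • a.2)
  iseqv :=
    { refl := fun a => ⟨1, by simp⟩
      symm := by
        rintro a b ⟨p, rfl⟩
        exact ⟨p⁻¹, by simp [← mul_smul]⟩
      trans := by
        rintro a b c ⟨p, rfl⟩ ⟨q, rfl⟩
        exact ⟨p * q, by simp [← mul_smul, ← MulOpposite.op_mul]⟩ }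

/-- The `Q`-set `V ×_P X = (V × X) / P`. -/
def tensor (V : FinBiset Q P) (X : FinGSet P) : FinGSet Q where
  carrier := Quotient (tensorSetoid V X)
  action :=
    { smul := fun q => Quotient.map (fun a => (q • a.1, a.2)) (by
        rintro a b ⟨p, rfl⟩
        exact ⟨p, by simp [smul_comm]⟩)
      one_smul := by
        rintro ⟨a⟩
        exact congrArg (Quotient.mk (tensorSetoid V X)) (Prod.ext (one_smul Q a.1) rfl)
      mul_smul := by
        rintro q q' ⟨a⟩
        exact congrArg (Quotient.mk (tensorSetoid V X)) (Prod.ext (mul_smul q q' a.1) rfl) }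

theorem tensor_iso (V : FinBiset Q P) {X Y : FinGSet P} (h : X.Iso Y) :
    (tensor V X).Iso (tensor V Y) := by
  obtain ⟨f, hf⟩ := h
  refine ⟨Quotient.congr (Equiv.prodCongr (Equiv.refl _) f) ?_, ?_⟩
  · rintro ⟨v, x⟩ ⟨w, y⟩
    constructor
    · rintro ⟨p, hp⟩
      obtain ⟨rfl, rfl⟩ := Prod.ext_iff.1 hp
      exact ⟨p, Prod.ext rfl (hf _ _)⟩
    · rintro ⟨p, hp⟩
      obtain ⟨h1, h2⟩ := Prod.ext_iff.1 hp
      exact ⟨p, Prod.ext h1 (f.injective (h2.trans (hf _ _).symm))⟩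
  · rintro q ⟨a⟩
    rfl

theorem tensor_empty_iso (V : FinBiset Q P) :
    (tensor V (FinGSet.empty P)).Iso (FinGSet.empty Q) := by
  have : IsEmpty (tensor V (FinGSet.empty P)).carrier := ⟨by
    rintro ⟨a⟩
    exact (a.2 : PEmpty).elim⟩
  exact ⟨(Equiv.equivPEmpty _ : _ ≃ PEmpty), fun _ x => isEmptyElim x⟩

theorem tensor_sum_iso (V : FinBiset Q P) (X Y : FinGSet P) :
    (tensor V (X.sum Y)).Iso ((tensor V X).sum (tensor V Y)) := by
  refine ⟨
    { toFun := Quotient.lift (fun a : V.carrier × (X.carrier ⊕ Y.carrier) =>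
        Sum.map (fun x => Quotient.mk (tensorSetoid V X) (a.1, x))
          (fun y => Quotient.mk (tensorSetoid V Y) (a.1, y)) a.2) ?_
      invFun := Sum.elim
        (Quotient.map (fun a => (a.1, Sum.inl a.2)) ?_)
        (Quotient.map (fun a => (a.1, Sum.inr a.2)) ?_)
      left_inv := ?_
      right_inv := ?_ }, ?_⟩
  · rintro ⟨v, x | y⟩ _ ⟨p, rfl⟩
    · exact congrArg Sum.inl (Quotient.sound ⟨p, rfl⟩)
    · exact congrArg Sum.inr (Quotient.sound ⟨p, rfl⟩)
  · rintro a _ ⟨p, rfl⟩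
    exact ⟨p, rfl⟩
  · rintro a _ ⟨p, rfl⟩
    exact ⟨p, rfl⟩
  · rintro ⟨v, x | y⟩ <;> rfl
  · rintro (⟨v, x⟩ | ⟨v, y⟩) <;> rfl
  · rintro q ⟨v, x | y⟩ <;> rfl

/-- Additive map on isomorphism classes induced by `X ↦ V ×_P X`. -/
def onClasses (V : FinBiset Q P) : GSetClass P →+ GSetClass Q where
  toFun := Quotient.map (tensor V) fun _ _ h => tensor_iso V h
  map_zero' := GSetClass.sound (tensor_empty_iso V)
  map_add' := GSetClass.ind fun X => GSetClass.ind fun Y => GSetClass.sound (tensor_sum_iso V X Y)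

/-- The linear map `𝔽B(V) : 𝔽B(P) → 𝔽B(Q)`, `[X] ↦ [V ×_P X]`. -/
noncomputable def onFBurnside (F : Type v) [Field F] (V : FinBiset Q P) :
    FBurnside F P →ₗ[F] FBurnside F Q :=
  FBurnside.map F V.onClasses

theorem onFBurnside_cls (F : Type v) [Field F] (V : FinBiset Q P) (X : FinGSet P) :
    V.onFBurnside F (FBurnside.cls F X) = FBurnside.cls F (V.tensor X) :=
  FBurnside.map_cls F _ X

/-- The left action `(h, k) · (u, l) = (h u, k l)` of `H × K` on `U × K`. -/
abbrev shiftLeft (K : Type u) [Group K] (U : FinBiset H G) :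
    MulAction (H × K) (U.carrier × K) where
  smul h a := (h.1 • a.1, h.2 * a.2)
  one_smul a := Prod.ext (one_smul H a.1) (one_mul a.2)
  mul_smul h h' a := Prod.ext (mul_smul h.1 h'.1 a.1) (mul_assoc h.2 h'.2 a.2)

/-- The right action `(u, l) · (g, k) = (u g, l k)` of `G × K` on `U × K`. -/
abbrev shiftRight (K : Type u) [Group K] (U : FinBiset H G) :
    MulAction (G × K)ᵐᵒᵖ (U.carrier × K) where
  smul g a := (MulOpposite.op g.unop.1 • a.1, a.2 * g.unop.2)
  one_smul a := Prod.ext (one_smul Gᵐᵒᵖ a.1) (mul_one a.2)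
  mul_smul g g' a := Prod.ext
    (mul_smul (MulOpposite.op g.unop.1) (MulOpposite.op g'.unop.1) a.1)
    (mul_assoc a.2 g'.unop.2 g.unop.2).symm

/-- For an `(H, G)`-biset `U`, the `(H × K, G × K)`-biset `U × K`, where `K` acts on both sides by
multiplication on the second component. -/
def shift (K : Type u) [Group K] [Finite K] (U : FinBiset H G) : FinBiset (H × K) (G × K) where
  carrier := U.carrier × K
  leftAction := U.shiftLeft K
  rightAction := U.shiftRight K
  smulComm := by
    let _ := U.shiftLeft K
    let _ := U.shiftRight K
    exact ⟨fun h g a => Prod.ext (smul_comm h.1 (MulOpposite.op g.unop.1) a.1)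
      (mul_assoc h.2 a.2 g.unop.2).symm⟩

end FinBiset

/-! ## The shifted Burnside functor and its ideals -/

/-- The evaluation `𝔽B_K(G) = 𝔽B(G × K)` of the shifted Burnside functor. -/
abbrev ShiftedBurnside (F : Type v) [Field F] (K : Type u) [Group K] (G : Type u) [Group G] :
    Type (max v (u + 1)) :=
  FBurnside F (G × K)

namespace ShiftedBurnside

variable (F : Type v) [Field F] (K : Type u) [Group K] {G H : Type u} [Group G] [Group H]

/-- The map `𝔽B_K(U) = 𝔽B(U × K) : 𝔽B_K(G) → 𝔽B_K(H)` of an `(H, G)`-biset `U`. -/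
noncomputable def mapBiset [Finite K] (U : FinBiset H G) :
    ShiftedBurnside F K G →ₗ[F] ShiftedBurnside F K H :=
  (U.shift K).onFBurnside F

/-- The injective homomorphism `(g, h, k) ↦ (g, k, h, k)`, i.e. the inverse of the isomorphism
`δ : Δ → G × H × K` followed by the inclusion of `Δ = {(g, k, h, k)}`. -/
def diag (K G H : Type u) [Group K] [Group G] [Group H] :
    (G × H) × K →* (G × K) × (H × K) where
  toFun x := ((x.1.1, x.2), (x.1.2, x.2))
  map_one' := rfl
  map_mul' _ _ := rfl

/-- The product `𝔽B_K(G) × 𝔽B_K(H) → 𝔽B_K(G × H)` of the Green biset functor `𝔽B_K`: the product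
of `𝔽B`, with values in `𝔽B(G × K × H × K)`, followed by restriction to `Δ ≅ G × H × K`. -/
noncomputable def mul (α : ShiftedBurnside F K G) (β : ShiftedBurnside F K H) :
    ShiftedBurnside F K (G × H) :=
  FBurnside.pullback F (diag K G H) (FBurnside.prod F α β)

end ShiftedBurnside

/-- An ideal of the Green biset functor `𝔽B_K`: a family of subspaces `I(G) ⊆ 𝔽B_K(G)`, for all
finite groups `G`, which is stable under the action of finite bisets (hence of their linear
combinations) and under the products `𝔽B_K(G) × I(H) → I(G × H)`.
As `𝔽B_K` is commutative, left ideals are two-sided. -/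
structure ShiftedBurnsideIdeal (F : Type v) [Field F] (K : Type u) [Group K] [Finite K] where
  eval (G : Type u) [Group G] [Finite G] : Submodule F (ShiftedBurnside F K G)
  map_mem {G H : Type u} [Group G] [Finite G] [Group H] [Finite H] (U : FinBiset H G)
    {x : ShiftedBurnside F K G} (hx : x ∈ eval G) : ShiftedBurnside.mapBiset F K U x ∈ eval H
  mul_mem {G H : Type u} [Group G] [Finite G] [Group H] [Finite H]
    (α : ShiftedBurnside F K G) {β : ShiftedBurnside F K H} (hβ : β ∈ eval H) :
    ShiftedBurnside.mul F K α β ∈ eval (G × H)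

namespace ShiftedBurnsideIdeal

variable {F : Type v} [Field F] {K : Type u} [Group K] [Finite K]

/-- Inclusion of ideals: `I ⊆ J` if `I(G) ⊆ J(G)` for every finite group `G`. -/
instance : LE (ShiftedBurnsideIdeal F K) where
  le I J := ∀ (G : Type u) [Group G] [Finite G], I.eval G ≤ J.eval G

/-- The ideal of `𝔽B_K` generated by an element `a ∈ 𝔽B_K(L)`: the intersection of all ideals
`I` such that `a ∈ I(L)`. -/
def generatedBy {L : Type u} [Group L] [Finite L] (a : ShiftedBurnside F K L) :
    ShiftedBurnsideIdeal F K where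
  eval G _ _ := ⨅ (I : ShiftedBurnsideIdeal F K) (_ : a ∈ I.eval L), I.eval G
  map_mem U x hx := by
    simp only [Submodule.mem_iInf] at hx ⊢
    exact fun I hI => I.map_mem U (hx I hI)
  mul_mem α β hβ := by
    simp only [Submodule.mem_iInf] at hβ ⊢
    exact fun I hI => I.mul_mem α (hβ I hI)

end ShiftedBurnsideIdeal

/-! ## Idempotents, groups over `K`, and `B_K`-groups -/

section Moebius

open Classical in
/-- The Möbius function `μ(X, Y)` of the poset of subgroups of a finite group. -/
noncomputable def subgroupMoebius {G : Type u} [Group G] [Finite G] (X Y : Subgroup G) : ℤ :=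
  letI : Fintype (Subgroup G) := Fintype.ofFinite _
  letI : LocallyFiniteOrder (Subgroup G) := Fintype.toLocallyFiniteOrder
  IncidenceAlgebra.mu ℤ X Y

end Moebius

/-- The idempotent
`e_L^G = |N_G(L)|⁻¹ ∑_{X ≤ L} |X| μ(X, L) [G / X]` of `𝔽B(G)`, for a subgroup `L` of `G`. -/
noncomputable def burnsideIdempotent (F : Type v) [Field F] {G : Type u} [Group G] [Finite G]
    (L : Subgroup G) : FBurnside F G :=
  (Nat.card (Subgroup.normalizer (L : Set G)) : F)⁻¹ •
    ∑ X ∈ (Set.toFinite {X : Subgroup G | X ≤ L}).toFinset,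
      ((Nat.card X : F) * (subgroupMoebius X L : F)) • FBurnside.cls F (FinGSet.coset X)

/-- The rational number `m_{L,N} = |L|⁻¹ ∑_{X ≤ L, XN = L} |X| μ(X, L)`, for `N` normal in `L`. -/
noncomputable def mInvariant {L : Type u} [Group L] [Finite L] (N : Subgroup L) : ℚ :=
  (Nat.card L : ℚ)⁻¹ *
    ∑ X ∈ (Set.toFinite {X : Subgroup L | X ⊔ N = ⊤}).toFinset,
      (Nat.card X : ℚ) * (subgroupMoebius X ⊤ : ℚ)

/-- For finite groups over `K`, given by homomorphisms `ψ : M → K` and `φ : L → K`,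
`(L, φ)` is a quotient of `(M, ψ)`: there are a surjective homomorphism `f : M → L` and an inner
automorphism `i` of `K` such that `i ∘ ψ = φ ∘ f`. -/
def HasQuotientOver {K L M : Type u} [Group K] [Group L] [Group M] (ψ : M →* K) (φ : L →* K) :
    Prop :=
  ∃ f : M →* L, Function.Surjective f ∧
    ∃ k : K, ∀ m : M, MulAut.conj k (ψ m) = φ (f m)

/-- `(L, φ)` is a `B_K`-group: `m_{L,N} = 0` for every non-trivial normal subgroup `N` of `L`
contained in `Ker φ`. -/
def IsRelativeBGroup {K L : Type u} [Group K] [Group L] [Finite L] (φ : L →* K) : Prop :=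
  ∀ N : Subgroup L, N.Normal → N ≠ ⊥ → N ≤ φ.ker → mInvariant N = 0

/-- The ideal `𝖾_{L,φ}` of `𝔽B_K` generated by the idempotent `e_{L_φ}^{L × K} ∈ 𝔽B_K(L)`, where
`L_φ = {(l, φ(l)) | l ∈ L}` is the graph of `φ`. -/
noncomputable def idempotentIdeal (F : Type v) [Field F] {K L : Type u} [Group K] [Finite K]
    [Group L] [Finite L] (φ : L →* K) : ShiftedBurnsideIdeal F K :=
  ShiftedBurnsideIdeal.generatedBy (burnsideIdempotent F φ.graph : ShiftedBurnside F K L)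

/-- The restriction `p₂ : X → K` of the second projection to a subgroup `X ≤ G × K`. -/
def subgroupSnd {G K : Type u} [Group G] [Group K] (X : Subgroup (G × K)) : X →* K :=
  (MonoidHom.snd G K).comp X.subtype

/-! ### Möbius functions of subgroup lattices -/

section MoebiusLemmas

open scoped Classical

variable {G H : Type u} [Group G] [Finite G] [Group H] [Finite H]

/-! In characteristic 0 an element of 𝔽B(Γ) is determined by its marks (numbers of fixed points of
subgroups), and the marks of e_X are non-zero exactly at the conjugates of X. So every α is a
combination of the e_X with non-zero mark of α at X (`FBurnside.mem_span_burnsideIdempotent`).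
Conversely an ideal containing α contains each of these e_X, since multiplying by e_X and
restricting along the diagonal yields mark_X(α) e_X (`ShiftedBurnsideIdeal.burnsideIdempotent_mem`).
Evaluations of ideals are therefore spans of idempotents, and the question is which X occur.

Lower bound (`burnsideIdempotent_mem_idempotentIdeal`): given a surjection f : X → L with φ ∘ f
conjugate to p₂, restriction of e_{L_φ} along f produces the idempotent of the graph of φ ∘ f, and
induction along X → G produces that of a conjugate of X.

Upper bound: the elements whose marks live on subgroups X ↠ (L, φ) form an ideal (`quotientIdeal`).
The difficulty is stability under a biset U. Up to a non-zero scalar, the mark at Y of the image of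
e_X is a sum over the points v of U × K, and v contributes only if Yv = vX and m_{X,R} ≠ 0, where R
is the stabilizer of v in X (`FinBiset.exists_of_mark_onFBurnside_ne_zero`). Then X/R is a quotient
of Y, compatibly with the maps to K up to conjugation, so it suffices that X/R ↠ (L, φ).

This is the group-theoretic core, `exists_quotient_of_mInvariant_ne_zero`: when (L, φ) is a
B_K-group and m_{X,R} ≠ 0, the surjection X → L can be chosen to kill R. Multiplicativity of m
(`mInvariant_comap`) reduces this to R minimal normal. If the given f does not kill R, then either R
and ker f have no proper common supplement, which gives m_{X,R} = m_{L,f(R)} = 0, or such a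
supplement is a complement of R and yields a new surjection.

For part 2, the mark of e_{M_ψ} at M_ψ itself is non-zero. -/

theorem subgroupMoebius_eq_zero {X Y : Subgroup G} (h : ¬X ≤ Y) : subgroupMoebius X Y = 0 :=
  IncidenceAlgebra.apply_eq_zero_of_not_le h _

theorem sum_subgroupMoebius_left [Fintype (Subgroup G)] (X Y : Subgroup G) :
    ∑ Z with X ≤ Z, subgroupMoebius Z Y = if X = Y then 1 else 0 := by
  let : Fintype (Subgroup G) := Fintype.ofFinite _
  let : LocallyFiniteOrder (Subgroup G) := Fintype.toLocallyFiniteOrder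
  rw [← IncidenceAlgebra.sum_Icc_mu_left (𝕜 := ℤ) X Y]
  symm
  refine Finset.sum_subset (fun Z hZ => by simpa using (Finset.mem_Icc.1 hZ).1)
    fun Z hZ hZ' => ?_
  · exact IncidenceAlgebra.apply_eq_zero_of_not_le
      (fun h => hZ' (Finset.mem_Icc.2 ⟨by simpa using hZ, h⟩)) _

theorem sum_subgroupMoebius_right [Fintype (Subgroup G)] (X Y : Subgroup G) :
    ∑ Z with Z ≤ Y, subgroupMoebius X Z = if X = Y then 1 else 0 := by
  let : Fintype (Subgroup G) := Fintype.ofFinite _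
  let : LocallyFiniteOrder (Subgroup G) := Fintype.toLocallyFiniteOrder
  rw [← IncidenceAlgebra.sum_Icc_mu_right (𝕜 := ℤ) X Y]
  symm
  refine Finset.sum_subset (fun Z hZ => by simpa using (Finset.mem_Icc.1 hZ).2)
    fun Z hZ hZ' => ?_
  · exact IncidenceAlgebra.apply_eq_zero_of_not_le
      (fun h => hZ' (Finset.mem_Icc.2 ⟨h, by simpa using hZ⟩)) _

/-- Functions on an upper set of a finite order are determined by their sums over the upper
intervals. -/
theorem eq_on_of_sum_Ici_eq {α R : Type*} [PartialOrder α] [Fintype α] [AddCommGroup R]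
    {P : α → Prop} (hP : ∀ a b, a ≤ b → P a → P b) {f g : α → R}
    (h : ∀ a, P a → ∑ b with a ≤ b, f b = ∑ b with a ≤ b, g b) (a : α) (ha : P a) :
    f a = g a := by
  induction a using (Finite.to_wellFoundedGT (α := α)).wf.induction with
  | _ a ih =>
    have key : ∀ u : α → R, ∑ b with a ≤ b, u b = u a + ∑ b with a < b, u b := by
      intro u
      have : (Finset.univ.filter fun b => a ≤ b) =
          insert a (Finset.univ.filter fun b => a < b) := by
        ext b
        simp [le_iff_eq_or_lt, eq_comm]
      rw [this, Finset.sum_insert (by simp)]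
    have h1 := h a ha
    rw [key, key, Finset.sum_congr rfl fun b hb => ih b (by simpa using hb)
      (hP a b (by simpa using hb : a < b).le ha)] at h1
    exact add_right_cancel h1

/-- Both sides obey the same recursion over upper intervals: a subgroup above e A but outside the
image of e is not below e Y, so its Möbius value vanishes. -/
theorem subgroupMoebius_map {e : Subgroup H → Subgroup G} (he : ∀ A B, e A ≤ e B ↔ A ≤ B)
    {Y : Subgroup H} (hr : ∀ A Z, e A ≤ Z → Z ≤ e Y → ∃ B, e B = Z) (A : Subgroup H) :
    subgroupMoebius (e A) (e Y) = subgroupMoebius A Y := by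
  cases nonempty_fintype (Subgroup G)
  cases nonempty_fintype (Subgroup H)
  have hinj : Function.Injective e := fun A B h =>
    le_antisymm ((he A B).1 h.le) ((he B A).1 h.ge)
  refine eq_on_of_sum_Ici_eq (P := fun _ => True) (fun _ _ _ _ => trivial)
    (f := fun A => subgroupMoebius (e A) (e Y)) (g := fun A => subgroupMoebius A Y)
    (fun A _ => ?_) A trivial
  have h1 := sum_subgroupMoebius_left (e A) (e Y)
  rw [sum_subgroupMoebius_left]
  simp only [hinj.eq_iff] at h1
  rw [← h1, ← Finset.sum_image (f := fun Z => subgroupMoebius Z (e Y)) (g := e)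
    (fun _ _ _ _ h => hinj h)]
  refine Finset.sum_subset (fun Z hZ => ?_) fun Z hZ hZ' => ?_
  · obtain ⟨B, hB, rfl⟩ := Finset.mem_image.1 hZ
    simpa [he] using hB
  · apply subgroupMoebius_eq_zero
    intro hZY
    have hAZ : e A ≤ Z := by simpa using hZ
    obtain ⟨B, rfl⟩ := hr A Z hAZ hZY
    exact hZ' (Finset.mem_image_of_mem _ (by simpa [he] using hAZ))

theorem subgroupMoebius_map_of_injective {i : H →* G} (hi : Function.Injective i)
    (A : Subgroup H) : subgroupMoebius (A.map i) i.range = subgroupMoebius A ⊤ := by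
  rw [MonoidHom.range_eq_map]
  refine subgroupMoebius_map (e := Subgroup.map i)
    (fun A B => Subgroup.map_le_map_iff_of_injective hi) (fun A Z _ hZ => ⟨Z.comap i, ?_⟩) A
  rw [Subgroup.map_comap_eq, inf_eq_right, MonoidHom.range_eq_map]
  exact hZ

theorem subgroupMoebius_comap_of_surjective {p : G →* H} (hp : Function.Surjective p)
    (A : Subgroup H) : subgroupMoebius (A.comap p) ⊤ = subgroupMoebius A ⊤ := by
  rw [← Subgroup.comap_top p]
  refine subgroupMoebius_map (e := Subgroup.comap p)
    (fun A B => Subgroup.comap_le_comap_of_surjective hp) (fun A Z hA _ => ⟨Z.map p, ?_⟩) A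
  rw [Subgroup.comap_map_eq, sup_eq_left]
  exact (Subgroup.ker_le_comap p A).trans hA

/-- Weisner's theorem. -/
theorem sum_subgroupMoebius_mul_inf_eq_zero {R : Type*} [Ring R] [Fintype (Subgroup G)]
    {X D : Subgroup G} (hD : ¬X ≤ D) (f : Subgroup G → R) :
    ∑ A, (subgroupMoebius A X : R) * f (A ⊓ D) = 0 := by
  -- The factor f is constant on the fibres of A ↦ A ⊓ D, so it suffices that μ(·, X) sums to zero
  -- on each fibre. Summing over all fibres above B gives the total of μ(A, X) over A ≥ B if B ≤ D,
  -- where B = X is excluded, and an empty sum otherwise.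
  have key : ∀ B : Subgroup G, ∑ A with A ⊓ D = B, subgroupMoebius A X = 0 := by
    intro B
    refine eq_on_of_sum_Ici_eq (P := fun _ => True) (fun _ _ _ _ => trivial)
      (f := fun B => ∑ A with A ⊓ D = B, subgroupMoebius A X) (g := fun _ => 0)
      (fun B _ => ?_) B trivial
    have h1 : ∀ A ∈ (Finset.univ.filter fun A : Subgroup G => B ≤ A ⊓ D),
        A ⊓ D ∈ Finset.univ.filter fun C : Subgroup G => B ≤ C := by simp
    have h2 := Finset.sum_fiberwise_of_maps_to h1 fun A => subgroupMoebius A X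
    rw [Finset.sum_const_zero]
    calc _ = ∑ A with B ≤ A ⊓ D, subgroupMoebius A X := by
          rw [← h2]
          refine Finset.sum_congr rfl fun C hC => Finset.sum_congr ?_ fun _ _ => rfl
          ext A
          simp only [Finset.mem_filter, Finset.mem_univ, true_and] at hC ⊢
          exact ⟨fun h => ⟨h ▸ hC, h⟩, fun h => h.2⟩
      _ = 0 := by
          by_cases hB : B ≤ D
          · simp only [le_inf_iff, hB, and_true]
            rw [sum_subgroupMoebius_left, if_neg]
            rintro rfl
            exact hD hB
          · exact Finset.sum_eq_zero fun A hA =>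
              absurd ((Finset.mem_filter.1 hA).2.trans inf_le_right) hB
  rw [← Finset.sum_fiberwise _ fun A => A ⊓ D]
  refine Finset.sum_eq_zero fun B _ => ?_
  calc _ = ((∑ A with A ⊓ D = B, subgroupMoebius A X : ℤ) : R) * f B := by
        push_cast
        rw [Finset.sum_mul]
        exact Finset.sum_congr rfl fun A hA => by rw [(Finset.mem_filter.1 hA).2]
    _ = 0 := by rw [key]; simp

end MoebiusLemmas

/-! ### The invariants m and quotients over K -/

section RelativeBGroups

open scoped Classical

theorem card_sup_mul_card_inf {G : Type*} [Group G] (Y N : Subgroup G) [N.Normal] :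
    Nat.card (Y ⊔ N : Subgroup G) * Nat.card (Y ⊓ N : Subgroup G) = Nat.card Y * Nat.card N := by
  have h1 := Subgroup.relIndex_mul_relIndex ⊥ N (Y ⊔ N) bot_le le_sup_right
  have h2 := Subgroup.relIndex_mul_relIndex ⊥ (N ⊓ Y) Y bot_le inf_le_right
  rw [Subgroup.inf_relIndex_right] at h2
  rw [Subgroup.relIndex_sup_right] at h1
  simp only [Subgroup.relIndex_bot_left] at h1 h2
  rw [← h1, ← h2, inf_comm]
  ring

/-- Dedekind's modular law: if z = yn with z in Z and n in N ≤ Z, then y lies in Z. It shows that a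
condition on YN depends only on Y ⊓ Z. -/
theorem inf_sup_eq_iff_of_le {G : Type*} [Group G] {Y Z N : Subgroup G} [N.Normal] (h : N ≤ Z) :
    (Y ⊓ Z) ⊔ N = Z ↔ Z ≤ Y ⊔ N := by
  refine ⟨fun hZ => hZ.ge.trans (sup_le_sup_right inf_le_left _), fun hZ =>
    le_antisymm (sup_le inf_le_right h) fun z hz => ?_⟩
  obtain ⟨y, hy, n, hn, rfl⟩ := Subgroup.mem_sup_of_normal_right.1 (hZ hz)
  exact Subgroup.mem_sup_of_normal_right.2
    ⟨y, ⟨hy, (mul_mem_cancel_right (h hn)).1 hz⟩, n, hn, rfl⟩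

theorem card_comap_mul_card {G H : Type*} [Group G] [Group H] {p : G →* H} (hp : Function.Surjective p) (A : Subgroup H) :
    Nat.card (A.comap p) * Nat.card H = Nat.card A * Nat.card G := by
  have h1 := (A.comap p).card_mul_index
  have h2 := A.card_mul_index
  rw [Subgroup.index_comap_of_surjective A hp] at h1
  rw [← h1, ← h2]
  ring

variable {G H K L : Type u} [Group G] [Finite G] [Group H] [Finite H] [Group K] [Group L] [Finite L]

theorem mInvariant_eq_sum [Fintype (Subgroup G)] (N : Subgroup G) :
    mInvariant N = (Nat.card G : ℚ)⁻¹ *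
      ∑ X with X ⊔ N = ⊤, (Nat.card X : ℚ) * (subgroupMoebius X ⊤ : ℚ) := by
  rw [mInvariant]
  congr 2
  ext
  simp

/-- XN = G gives |X| / |G| = |X ∩ N| / |N|. In this form the weight depends on X only through X ∩ N,
as Weisner's theorem requires. -/
theorem card_mul_mInvariant [Fintype (Subgroup G)] (N : Subgroup G) [N.Normal] :
    (Nat.card N : ℚ) * mInvariant N =
      ∑ X with X ⊔ N = ⊤, (Nat.card (X ⊓ N : Subgroup G) : ℚ) * (subgroupMoebius X ⊤ : ℚ) := by
  rw [mInvariant_eq_sum, ← mul_assoc, Finset.mul_sum]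
  refine Finset.sum_congr rfl fun X hX => ?_
  have h := card_sup_mul_card_inf X N
  rw [(Finset.mem_filter.1 hX).2, Subgroup.card_top] at h
  have h' : (Nat.card G : ℚ) * Nat.card (X ⊓ N : Subgroup G) = Nat.card X * Nat.card N := by
    exact_mod_cast h
  have h0 : (Nat.card G : ℚ) ≠ 0 := by exact_mod_cast Nat.card_pos.ne'
  rw [← mul_assoc]
  congr 1
  field_simp
  linarith

/-- Compare sums over all Z' ≥ Z. For Z = G this is the definition of m. For Z ≠ G the left side
runs over X with Z ≤ XN; by Dedekind's law both condition and weight depend only on X ∩ Z, so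
Weisner's theorem makes the sum vanish, as does the Möbius sum on the right. -/
theorem sum_subgroupMoebius_sup_eq [Fintype (Subgroup G)] (N Z : Subgroup G) [N.Normal]
    (hZ : N ≤ Z) :
    ∑ X with X ⊔ N = Z, (Nat.card (X ⊓ N : Subgroup G) : ℚ) * (subgroupMoebius X ⊤ : ℚ) =
      Nat.card N * mInvariant N * (subgroupMoebius Z ⊤ : ℚ) := by
  refine eq_on_of_sum_Ici_eq (P := fun Z => N ≤ Z) (fun _ _ h h' => h'.trans h)
    (f := fun Z => ∑ X with X ⊔ N = Z,
      (Nat.card (X ⊓ N : Subgroup G) : ℚ) * (subgroupMoebius X ⊤ : ℚ))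
    (g := fun Z => Nat.card N * mInvariant N * (subgroupMoebius Z ⊤ : ℚ)) (fun Z hZ => ?_) Z hZ
  rw [← Finset.mul_sum]
  have hs := sum_subgroupMoebius_left Z ⊤
  have hs' : ∑ W with Z ≤ W, (subgroupMoebius W ⊤ : ℚ) = if Z = ⊤ then 1 else 0 := by
    exact_mod_cast congrArg (Int.cast : ℤ → ℚ) hs
  rw [hs']
  have h1 : ∀ X ∈ (Finset.univ.filter fun X : Subgroup G => Z ≤ X ⊔ N),
      X ⊔ N ∈ Finset.univ.filter fun W : Subgroup G => Z ≤ W := by simp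
  have h2 := Finset.sum_fiberwise_of_maps_to h1 fun X =>
    (Nat.card (X ⊓ N : Subgroup G) : ℚ) * (subgroupMoebius X ⊤ : ℚ)
  calc _ = ∑ X with Z ≤ X ⊔ N,
        (Nat.card (X ⊓ N : Subgroup G) : ℚ) * (subgroupMoebius X ⊤ : ℚ) := by
        rw [← h2]
        refine Finset.sum_congr rfl fun C hC => Finset.sum_congr ?_ fun _ _ => rfl
        ext A
        simp only [Finset.mem_filter, Finset.mem_univ, true_and] at hC ⊢
        exact ⟨fun h => ⟨h ▸ hC, h⟩, fun h => h.2⟩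
    _ = _ := by
        split_ifs with hT
        · subst hT
          rw [mul_one, card_mul_mInvariant]
          simp only [top_le_iff]
        · rw [mul_zero, Finset.sum_filter]
          refine Eq.trans (Finset.sum_congr rfl fun X _ => ?_)
            (sum_subgroupMoebius_mul_inf_eq_zero (R := ℚ) (X := ⊤) (D := Z)
              (by rwa [top_le_iff])
              fun B => if B ⊔ N = Z then (Nat.card (B ⊓ N : Subgroup G) : ℚ) else 0)
          rw [inf_sup_eq_iff_of_le hZ, inf_assoc, inf_eq_right.2 hZ]
          split_ifs
          · rw [mul_comm]
          · rw [mul_zero]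

/-- The correspondence theorem: preimages under p preserve Möbius values and indices, hence the
ratios |B| / |H|. -/
theorem mInvariant_eq_sum_comap [Fintype (Subgroup G)] {p : G →* H} (hp : Function.Surjective p)
    (A : Subgroup H) :
    mInvariant A = (Nat.card G : ℚ)⁻¹ * ∑ Z with p.ker ≤ Z ∧ Z ⊔ A.comap p = ⊤,
      (Nat.card Z : ℚ) * (subgroupMoebius Z ⊤ : ℚ) := by
  cases nonempty_fintype (Subgroup H)
  rw [mInvariant_eq_sum, Finset.mul_sum, Finset.mul_sum]
  refine Finset.sum_bij' (fun B _ => B.comap p) (fun Z _ => Z.map p) ?_ ?_ ?_ ?_ ?_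
  · intro B hB
    simp only [Finset.mem_filter, Finset.mem_univ, true_and] at hB ⊢
    rw [Subgroup.comap_sup_eq _ _ _ hp, hB]
    exact ⟨Subgroup.ker_le_comap p B, Subgroup.comap_top p⟩
  · intro Z hZ
    simp only [Finset.mem_filter, Finset.mem_univ, true_and] at hZ ⊢
    apply Subgroup.comap_injective hp
    rw [← Subgroup.comap_sup_eq _ _ _ hp, Subgroup.comap_map_eq_self hZ.1, hZ.2,
      Subgroup.comap_top]
  · exact fun B _ => Subgroup.map_comap_eq_self_of_surjective hp B
  · exact fun Z hZ => Subgroup.comap_map_eq_self (Finset.mem_filter.1 hZ).2.1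
  · intro B _
    rw [subgroupMoebius_comap_of_surjective hp, ← mul_assoc, ← mul_assoc]
    congr 1
    have h : (Nat.card (B.comap p) : ℚ) * Nat.card H = Nat.card B * Nat.card G := by
      exact_mod_cast card_comap_mul_card hp B
    have h0 : (Nat.card G : ℚ) ≠ 0 := by exact_mod_cast Nat.card_pos.ne'
    have h0' : (Nat.card H : ℚ) ≠ 0 := by exact_mod_cast Nat.card_pos.ne'
    field_simp
    linarith

/-- Sort the supplements X of the preimage of A by Z = X ker p. Each class contributes m_{G, ker p}
|Z| μ(Z, G), and the Z that occur are those computing the invariant of A. -/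
theorem mInvariant_comap {p : G →* H} (hp : Function.Surjective p) (A : Subgroup H) :
    mInvariant (A.comap p) = mInvariant p.ker * mInvariant A := by
  cases nonempty_fintype (Subgroup G)
  rw [mInvariant_eq_sum, mInvariant_eq_sum_comap hp, mul_left_comm]
  congr 1
  have hk : p.ker ≤ A.comap p := Subgroup.ker_le_comap p A
  have h1 : ∀ X ∈ (Finset.univ.filter fun X : Subgroup G => X ⊔ A.comap p = ⊤),
      X ⊔ p.ker ∈ Finset.univ.filter fun Z : Subgroup G => p.ker ≤ Z ∧ Z ⊔ A.comap p = ⊤ := by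
    intro X hX
    simp only [Finset.mem_filter, Finset.mem_univ, true_and] at hX ⊢
    rw [sup_assoc, sup_eq_right.2 hk]
    exact ⟨le_sup_right, hX⟩
  rw [← Finset.sum_fiberwise_of_maps_to h1, Finset.mul_sum]
  refine Finset.sum_congr rfl fun Z hZ => ?_
  simp only [Finset.mem_filter, Finset.mem_univ, true_and] at hZ
  have hc : (Nat.card p.ker : ℚ) ≠ 0 := by exact_mod_cast Nat.card_pos.ne'
  apply mul_left_cancel₀ hc
  calc _ = ∑ X with X ⊔ p.ker = Z, (Nat.card Z : ℚ) *
        ((Nat.card (X ⊓ p.ker : Subgroup G) : ℚ) * (subgroupMoebius X ⊤ : ℚ)) := by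
        rw [Finset.mul_sum]
        refine Finset.sum_congr ?_ fun X hX => ?_
        · ext X
          simp only [Finset.mem_filter, Finset.mem_univ, true_and]
          refine ⟨fun h => h.2, fun h => ⟨?_, h⟩⟩
          rw [← hZ.2, ← h, sup_assoc, sup_eq_right.2 hk]
        · have h := card_sup_mul_card_inf X p.ker
          rw [(Finset.mem_filter.1 hX).2] at h
          have h' : (Nat.card Z : ℚ) * Nat.card (X ⊓ p.ker : Subgroup G) =
              Nat.card X * Nat.card p.ker := by exact_mod_cast h
          rw [← mul_assoc, ← mul_assoc, h']
          ring
    _ = _ := by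
        rw [← Finset.mul_sum, sum_subgroupMoebius_sup_eq p.ker Z hZ.1]
        ring

/-- A multiplicative relation which is total on `A`, composed with a homomorphism that is constant
on the elements related to a given one, is a homomorphism. -/
theorem exists_monoidHom_of_relation {A B C : Type*} [Group A] [Group B] [Group C]
    (R : A → B → Prop) (ht : ∀ a, ∃ b, R a b)
    (hm : ∀ a b a' b', R a b → R a' b' → R (a * a') (b * b')) (g : B →* C)
    (hg : ∀ a b b', R a b → R a b' → g b = g b') :
    ∃ h : A →* C, ∀ a b, R a b → h a = g b := by
  choose s hs using ht
  exact ⟨MonoidHom.mk' (fun a => g (s a)) fun a a' => by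
    rw [← map_mul]
    exact hg _ _ _ (hs _) (hm _ _ _ _ (hs a) (hs a')), fun a b h => hg _ _ _ (hs a) h⟩

/-- On the supplements Z of N, the functions μ(Z, G) and [M ≤ Z] μ(Z, G) have equal upper sums:
these detect Z = G and ZM = G, which are equivalent by hypothesis. Hence the functions agree. -/
theorem subgroupMoebius_eq_zero_of_sup_ne_top {N M Y : Subgroup G} (hN : Y ⊔ N = ⊤)
    (h : ∀ Z : Subgroup G, Z ⊔ N = ⊤ → Z ⊔ M = ⊤ → Z = ⊤) (hY : ¬M ≤ Y) :
    subgroupMoebius Y ⊤ = 0 := by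
  cases nonempty_fintype (Subgroup G)
  have := eq_on_of_sum_Ici_eq (P := fun Z : Subgroup G => Z ⊔ N = ⊤)
    (fun A B hAB hA => top_le_iff.1 (hA.ge.trans (sup_le_sup_right hAB N)))
    (f := fun Z => subgroupMoebius Z ⊤)
    (g := fun Z => if M ≤ Z then subgroupMoebius Z ⊤ else 0) (fun Z hZ => ?_) Y hN
  · simpa [hY] using this
  · rw [sum_subgroupMoebius_left, ← Finset.sum_filter, Finset.filter_filter]
    have : (Finset.univ.filter fun W => Z ≤ W ∧ M ≤ W) =
        Finset.univ.filter fun W : Subgroup G => Z ⊔ M ≤ W := by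
      ext; simp
    rw [this, sum_subgroupMoebius_left]
    refine if_congr ⟨fun hZ' => by rw [hZ', top_sup_eq], h Z hZ⟩ rfl rfl

/-- Base case of the next theorem. If f does not kill N, then N meets ker f trivially and two
situations remain, according to whether N and ker f have a proper common supplement. -/
theorem exists_quotient_of_minimal_normal {φ : L →* K} (hφ : IsRelativeBGroup φ) {ψ : G →* K}
    (hψ : HasQuotientOver ψ φ) {N : Subgroup G} [N.Normal] (hN : N ≤ ψ.ker)
    (hmin : ∀ N' : Subgroup G, N'.Normal → N' ≤ N → N' ≠ N → N' = ⊥)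
    (hm : mInvariant N ≠ 0) :
    ∃ f : G →* L, Function.Surjective f ∧ N ≤ f.ker ∧
      ∃ k : K, ∀ x, MulAut.conj k (ψ x) = φ (f x) := by
  cases nonempty_fintype (Subgroup G)
  obtain ⟨f, hf, k, hk⟩ := hψ
  by_cases hNM : N ≤ f.ker
  · exact ⟨f, hf, hNM, k, hk⟩
  have hdisj : N ⊓ f.ker = ⊥ := hmin _ inferInstance inf_le_left fun h => hNM (inf_eq_left.1 h)
  by_cases hY : ∀ Z : Subgroup G, Z ⊔ N = ⊤ → Z ⊔ f.ker = ⊤ → Z = ⊤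
  -- Without a proper common supplement, only subgroups containing ker f contribute to m_{G,N}. Thus
  -- m_{G,N} = m_{L,f(N)}, which vanishes because f(N) is non-trivial and contained in Ker φ.
  · exfalso
    have hmap : mInvariant (N.map f) = 0 := by
      refine hφ _ (Subgroup.Normal.map inferInstance f hf) (fun h => hNM ?_) ?_
      · rwa [Subgroup.map_eq_bot_iff] at h
      · rintro _ ⟨n, hn, rfl⟩
        rw [MonoidHom.mem_ker, ← hk, MonoidHom.mem_ker.1 (hN hn), map_one]
    apply hm
    rw [mInvariant_eq_sum]
    rw [mInvariant_eq_sum_comap hf] at hmap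
    rw [← hmap]
    congr 1
    symm
    refine Finset.sum_subset_zero_on_sdiff (fun Z hZ => ?_) (fun Z hZ => ?_) fun _ _ => rfl
    · simp only [Finset.mem_filter, Finset.mem_univ, true_and, Subgroup.comap_map_eq] at hZ ⊢
      rw [← hZ.2, sup_comm N, ← sup_assoc, sup_eq_left.2 hZ.1]
    · simp only [Finset.mem_sdiff, Finset.mem_filter, Finset.mem_univ, true_and, not_and,
        Subgroup.comap_map_eq] at hZ
      rw [subgroupMoebius_eq_zero_of_sup_ne_top hZ.1 hY fun h => hZ.2 h ?_]
      · simp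
      · rw [← sup_assoc, hZ.1, top_sup_eq]
  · push Not at hY
    obtain ⟨Y, hYN, hYM, hYT⟩ := hY
    -- Y normalizes Y ∩ N and ker f centralizes N, so Y ∩ N is normal in G = Y ker f. By minimality
    -- it is trivial or N, and the latter would force Y = G.
    have hYN' : Y ⊓ N = ⊥ := by
      refine hmin _ ⟨fun n hn g => ?_⟩ inf_le_right fun h => hYT ?_
      · obtain ⟨y, hy, m, hm, rfl⟩ := Subgroup.mem_sup_of_normal_right.1
          (hYM.ge (Subgroup.mem_top g))
        have hc : m * n * m⁻¹ = n := by
          rw [← Subgroup.commute_of_normal_of_disjoint N f.ker inferInstance inferInstance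
            (disjoint_iff.2 hdisj) n m hn.2 hm, mul_inv_cancel_right]
        have : y * m * n * (y * m)⁻¹ = y * n * y⁻¹ := by
          rw [mul_inv_rev, ← mul_assoc, mul_assoc y m n, mul_assoc y, hc]
        rw [this]
        exact ⟨Y.mul_mem (Y.mul_mem hy hn.1) (Y.inv_mem hy), Subgroup.Normal.conj_mem ‹_› n hn.2 y⟩
      · rw [← hYN, sup_eq_left.2 (inf_eq_right.1 h)]
    -- The new surjection is G = YN → Y followed by f. It kills N, it is onto since Y ker f = G, and
    -- it is compatible with ψ since N ≤ Ker ψ.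
    obtain ⟨g, hg⟩ := exists_monoidHom_of_relation (fun (x : G) (y : Y) => (y : G)⁻¹ * x ∈ N)
      (fun x => by
        obtain ⟨y, hy, n, hn, rfl⟩ := Subgroup.mem_sup_of_normal_right.1
          (hYN.ge (Subgroup.mem_top x))
        exact ⟨⟨y, hy⟩, by simpa⟩)
      (fun a b a' b' h h' => by
        have h1 := N.mul_mem (Subgroup.Normal.conj_mem ‹_› _ h (b' : G)⁻¹) h'
        simpa [mul_assoc] using h1)
      (f.comp Y.subtype)
      (fun a b b' h h' => by
        have h1 : ((b : G)⁻¹ * b' : G) ∈ Y ⊓ N :=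
          ⟨Y.mul_mem (Y.inv_mem b.2) b'.2, by simpa [mul_assoc] using N.mul_mem h (N.inv_mem h')⟩
        rw [hYN', Subgroup.mem_bot, inv_mul_eq_one] at h1
        rw [Subtype.ext h1])
    refine ⟨g, fun l => ?_, fun n hn => ?_, k, fun x => ?_⟩
    · obtain ⟨x, rfl⟩ := hf l
      obtain ⟨y, hy, m, hm, rfl⟩ := Subgroup.mem_sup_of_normal_right.1
        (hYM.ge (Subgroup.mem_top x))
      refine ⟨y, ?_⟩
      rw [hg y ⟨y, hy⟩ (by simp [N.one_mem]), map_mul, MonoidHom.mem_ker.1 hm, mul_one]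
      rfl
    · rw [MonoidHom.mem_ker, hg n 1 (by simpa), map_one]
    · obtain ⟨y, hy, n, hn, rfl⟩ := Subgroup.mem_sup_of_normal_right.1
        (hYN.ge (Subgroup.mem_top x))
      rw [hg _ ⟨y, hy⟩ (by simpa), map_mul, MonoidHom.mem_ker.1 (hN hn), mul_one, hk]
      rfl

/-- Induction on |G|: choose a minimal normal N₀ inside N. By multiplicativity both m_{G,N₀} and
m_{G/N₀,N/N₀} are non-zero. The first lets (L, φ) be a quotient of G/N₀, and the second allows the
induction to continue there. -/
theorem exists_quotient_of_mInvariant_ne_zero {φ : L →* K} (hφ : IsRelativeBGroup φ)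
    (n : ℕ) {G : Type u} [Group G] [Finite G] (hn : Nat.card G = n) {ψ : G →* K}
    (hψ : HasQuotientOver ψ φ) {N : Subgroup G} [N.Normal] (hN : N ≤ ψ.ker)
    (hm : mInvariant N ≠ 0) :
    ∃ f : G →* L, Function.Surjective f ∧ N ≤ f.ker ∧
      ∃ k : K, ∀ x, MulAut.conj k (ψ x) = φ (f x) := by
  induction n using Nat.strong_induction_on generalizing G with
  | _ n ih =>
    by_cases hbot : N = ⊥
    · obtain ⟨f, hf, k, hk⟩ := hψ
      exact ⟨f, hf, hbot ▸ bot_le, k, hk⟩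
    obtain ⟨N₀, ⟨hn₀, hle, hne⟩, hmin⟩ := Set.Finite.exists_minimal
      (Set.toFinite {N' : Subgroup G | N'.Normal ∧ N' ≤ N ∧ N' ≠ ⊥}) ⟨N, inferInstance, le_rfl, hbot⟩
    have hp := QuotientGroup.mk'_surjective N₀
    have hcm : (N.map (QuotientGroup.mk' N₀)).comap (QuotientGroup.mk' N₀) = N := by
      rw [Subgroup.comap_map_eq_self]
      rwa [QuotientGroup.ker_mk']
    have hmul := mInvariant_comap hp (N.map (QuotientGroup.mk' N₀))
    rw [hcm, QuotientGroup.ker_mk'] at hmul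
    rw [hmul] at hm
    obtain ⟨g, hg, hgN, k, hk⟩ := exists_quotient_of_minimal_normal hφ hψ (hle.trans hN)
      (fun N' h1 h2 h3 => by
        by_contra h4
        exact h3 (le_antisymm h2 (hmin ⟨h1, h2.trans hle, h4⟩ h2))) (left_ne_zero_of_mul hm)
    have hlt : Nat.card (G ⧸ N₀) < n := by
      have h1 := Subgroup.card_eq_card_quotient_mul_card_subgroup N₀
      have h2 : 1 < Nat.card N₀ := (Subgroup.one_lt_card_iff_ne_bot N₀).2 hne
      have h3 : 0 < Nat.card (G ⧸ N₀) := Nat.card_pos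
      rw [← hn, h1]
      exact lt_mul_of_one_lt_right h3 h2
    have : (N.map (QuotientGroup.mk' N₀)).Normal := Subgroup.Normal.map inferInstance _ hp
    -- The map g only certifies that G/N₀ has (L, φ) as a quotient; induction may return a different
    -- surjection and a different conjugating element.
    obtain ⟨f, hf, hfN, k', hk'⟩ := ih _ hlt (G := G ⧸ N₀) rfl
      (ψ := QuotientGroup.lift N₀ ψ (hle.trans hN))
      ⟨QuotientGroup.lift N₀ g hgN, QuotientGroup.lift_surjective_of_surjective _ _ hg _, k, by
        rintro ⟨x⟩
        exact hk x⟩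
      (N := N.map (QuotientGroup.mk' N₀)) (by
        rintro _ ⟨x, hx, rfl⟩
        exact hN hx) (right_ne_zero_of_mul hm)
    refine ⟨f.comp (QuotientGroup.mk' N₀), hf.comp hp, fun x hx => ?_, k', fun x => hk' (x : G ⧸ N₀)⟩
    exact hfN (Subgroup.mem_map_of_mem _ hx)

end RelativeBGroups

/-! ### Marks and the idempotent basis -/

section Marks

open scoped Classical

theorem FBurnside.linearMap_ext {F : Type v} [Field F] {G : Type u} [Group G] {V : Type*}
    [AddCommGroup V] [Module F V] {f g : FBurnside F G →ₗ[F] V}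
    (h : ∀ X : FinGSet G, f (cls F X) = g (cls F X)) : f = g := by
  refine TensorProduct.AlgebraTensorModule.ext fun r b => ?_
  have key : (f.toAddMonoidHom.comp (TensorProduct.mk ℤ F (BurnsideGroup G) 1).toAddMonoidHom) =
      (g.toAddMonoidHom.comp (TensorProduct.mk ℤ F (BurnsideGroup G) 1).toAddMonoidHom) :=
    BurnsideGroup.hom_ext (GSetClass.ind h)
  have h1 := DFunLike.congr_fun key b
  have h2 : r ⊗ₜ[ℤ] b = r • ((1 : F) ⊗ₜ[ℤ] b) := by simp [TensorProduct.smul_tmul']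
  rw [h2, map_smul, map_smul]
  exact congrArg (r • ·) h1

theorem FBurnside.mem_of_cls_mem {F : Type v} [Field F] {G : Type u} [Group G]
    (S : Submodule F (FBurnside F G)) (h : ∀ X : FinGSet G, cls F X ∈ S) (α : FBurnside F G) :
    α ∈ S := by
  have h1 : S.mkQ = 0 := linearMap_ext fun X => by simpa using h X
  simpa using DFunLike.congr_fun h1 α

/-- The complement of an orbit of a finite `G`-set. -/
def FinGSet.orbitCompl {G : Type u} [Group G] (X : FinGSet G) (x : X.carrier) : FinGSet G where
  carrier := {y : X.carrier // y ∉ MulAction.orbit G x}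
  action :=
    { smul := fun g y => ⟨g • y.1, fun h => y.2 (by
        simpa using MulAction.mem_orbit_of_mem_orbit g⁻¹ h)⟩
      one_smul := fun y => Subtype.ext (one_smul G y.1)
      mul_smul := fun g g' y => Subtype.ext (mul_smul g g' y.1) }

theorem FinGSet.coset_sum_orbitCompl_iso {G : Type u} [Group G] [Finite G] (X : FinGSet G)
    (x : X.carrier) :
    ((coset (MulAction.stabilizer G x)).sum (X.orbitCompl x)).Iso X := by
  refine ⟨Equiv.ofBijective (Sum.elim (MulAction.ofQuotientStabilizer G x) Subtype.val)
    ⟨?_, fun y => ?_⟩, ?_⟩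
  · have h0 : ∀ a, MulAction.ofQuotientStabilizer G x a ∈ MulAction.orbit G x :=
      MulAction.ofQuotientStabilizer_mem_orbit G x
    rintro (a | a) (b | b) h
    · exact congrArg Sum.inl (MulAction.injective_ofQuotientStabilizer G x h)
    · exact (b.2 (by rw [show b.1 = _ from h.symm]; exact h0 a)).elim
    · exact (a.2 (by rw [show a.1 = _ from h]; exact h0 b)).elim
    · exact congrArg Sum.inr (Subtype.ext h)
  · by_cases hy : y ∈ MulAction.orbit G x
    · obtain ⟨g, rfl⟩ := hy
      exact ⟨Sum.inl (QuotientGroup.mk g), rfl⟩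
    · exact ⟨Sum.inr ⟨y, hy⟩, rfl⟩
  · rintro g (a | a)
    · exact MulAction.ofQuotientStabilizer_smul G x g a
    · rfl

theorem FBurnside.mem_of_cls_coset_mem {F : Type v} [Field F] {G : Type u} [Group G] [Finite G]
    (S : Submodule F (FBurnside F G)) (h : ∀ A : Subgroup G, cls F (FinGSet.coset A) ∈ S)
    (α : FBurnside F G) : α ∈ S := by
  refine mem_of_cls_mem S (fun X => ?_) α
  induction hn : Nat.card X.carrier using Nat.strong_induction_on generalizing X with
  | _ n ih =>
    rcases isEmpty_or_nonempty X.carrier with he | ⟨⟨x⟩⟩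
    · have h1 : cls F X = 0 := by
        have h2 : X.Iso (X.sum X) :=
          ⟨Equiv.equivOfIsEmpty X.carrier (X.carrier ⊕ X.carrier), fun _ x => isEmptyElim x⟩
        simpa [cls_sum] using cls_eq_of_iso F h2
      rw [h1]
      exact S.zero_mem
    · rw [← cls_eq_of_iso F (X.coset_sum_orbitCompl_iso x), cls_sum]
      refine S.add_mem (h _) (ih _ ?_ _ rfl)
      rw [← hn]
      exact Finite.card_subtype_lt (x := x) (fun h => h (MulAction.mem_orbit_self x))

/-- The fixed points of a subgroup on a finite `G`-set. -/
def FinGSet.fixedBy {G : Type u} [Group G] (H : Subgroup G) (X : FinGSet G) : Set X.carrier :=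
  {x | ∀ h ∈ H, h • x = x}

/-- The number of fixed points of a subgroup, on isomorphism classes of finite `G`-sets. -/
noncomputable def GSetClass.mark {G : Type u} [Group G] (H : Subgroup G) : GSetClass G →+ ℕ where
  toFun := Quotient.lift (fun X : FinGSet G => Nat.card (X.fixedBy H)) (by
    rintro X Y ⟨f, hf⟩
    refine Nat.card_congr (f.subtypeEquiv fun x => forall₂_congr fun h _ => ?_)
    rw [← hf, f.apply_eq_iff_eq])
  map_zero' := by
    have : IsEmpty ((FinGSet.empty G).fixedBy H) := ⟨fun x => (x.1 : PEmpty).elim⟩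
    exact Nat.card_of_isEmpty
  map_add' := GSetClass.ind fun X => GSetClass.ind fun Y => by
    refine Eq.trans (Nat.card_congr ?_) Nat.card_sum
    exact
      { toFun := fun x => match x with
          | ⟨Sum.inl x, hx⟩ => Sum.inl ⟨x, fun h hh => Sum.inl_injective (hx h hh)⟩
          | ⟨Sum.inr x, hx⟩ => Sum.inr ⟨x, fun h hh => Sum.inr_injective (hx h hh)⟩
        invFun := Sum.elim (fun x => ⟨Sum.inl x.1, fun h hh => congrArg Sum.inl (x.2 h hh)⟩)
          (fun x => ⟨Sum.inr x.1, fun h hh => congrArg Sum.inr (x.2 h hh)⟩)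
        left_inv := by rintro ⟨x | x, hx⟩ <;> rfl
        right_inv := by rintro (x | x) <;> rfl }

/-- The linear form on `𝔽B(G)` counting the fixed points of a subgroup. -/
noncomputable def FBurnside.mark (F : Type v) [Field F] {G : Type u} [Group G] (H : Subgroup G) :
    FBurnside F G →ₗ[F] F :=
  LinearMap.liftBaseChange F (AddMonoidHom.toIntLinearMap (Algebra.GrothendieckAddGroup.lift
    ((Nat.castAddMonoidHom F).comp (GSetClass.mark H))))

namespace FBurnside

variable (F : Type v) [Field F] {G H : Type u} [Group G] [Group H]

theorem mark_cls (A : Subgroup G) (X : FinGSet G) :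
    mark F A (cls F X) = Nat.card (X.fixedBy A) := by
  simp only [mark, cls, LinearMap.liftBaseChange_tmul, one_smul, AddMonoidHom.coe_toIntLinearMap,
    BurnsideGroup.lift_of]
  rfl

theorem mark_pullback (f : G →* H) (A : Subgroup G) (α : FBurnside F H) :
    mark F A (pullback F f α) = mark F (A.map f) α := by
  refine DFunLike.congr_fun (f := (mark F A).comp (pullback F f)) (linearMap_ext fun X => ?_) α
  rw [LinearMap.comp_apply, pullback_cls, mark_cls, mark_cls]
  have : (X.pullback f).fixedBy A = X.fixedBy (A.map f) := by
    ext x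
    exact ⟨by rintro hx _ ⟨a, ha, rfl⟩; exact hx a ha, fun hx a ha => hx _ ⟨a, ha, rfl⟩⟩
  rw [this]
  rfl

theorem mark_prod (A : Subgroup (G × H)) (α : FBurnside F G) (β : FBurnside F H) :
    mark F A (prod F α β) =
      mark F (A.map (MonoidHom.fst G H)) α * mark F (A.map (MonoidHom.snd G H)) β := by
  have key : (prod F).compr₂ (mark F A) = (LinearMap.mul F F).compl₁₂
      (mark F (A.map (MonoidHom.fst G H))) (mark F (A.map (MonoidHom.snd G H))) := by
    refine linearMap_ext fun X => linearMap_ext fun Y => ?_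
    simp only [LinearMap.compr₂_apply, LinearMap.compl₁₂_apply, LinearMap.mul_apply', prod_cls,
      mark_cls]
    rw [← Nat.cast_mul, ← Nat.card_prod]
    congr 1
    refine Nat.card_congr (Equiv.trans (Equiv.subtypeEquivRight fun x => ?_)
      (Equiv.subtypeProdEquivProd (p := (· ∈ X.fixedBy _)) (q := (· ∈ Y.fixedBy _))))
    constructor
    · intro hx
      constructor
      · rintro _ ⟨a, ha, rfl⟩
        exact congrArg Prod.fst (hx a ha)
      · rintro _ ⟨a, ha, rfl⟩
        exact congrArg Prod.snd (hx a ha)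
    · exact fun hx a ha => Prod.ext (hx.1 _ ⟨a, ha, rfl⟩) (hx.2 _ ⟨a, ha, rfl⟩)
  exact LinearMap.congr_fun₂ key α β

theorem mark_conj (g : G) (A : Subgroup G) (α : FBurnside F G) :
    mark F (A.map (MulAut.conj g).toMonoidHom) α = mark F A α := by
  refine DFunLike.congr_fun (linearMap_ext fun X => ?_) α
  rw [mark_cls, mark_cls]
  congr 1
  refine Nat.card_congr ((MulAction.toPerm g).subtypeEquiv fun x => ?_).symm
  constructor
  · rintro hx _ ⟨a, ha, rfl⟩
    simp [mul_smul, hx a ha]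
  · intro hx a ha
    have := hx _ ⟨a, ha, rfl⟩
    simpa [mul_smul] using this

variable [Finite G]

/-- The coset gA is fixed by B exactly when g⁻¹Bg ≤ A, and each coset has |A| representatives g. -/
theorem card_mul_mark_coset [Fintype G] (A B : Subgroup G) :
    (Nat.card A : F) * mark F B (cls F (FinGSet.coset A)) =
      ∑ g : G, if B.map (MulAut.conj g⁻¹).toMonoidHom ≤ A then (1 : F) else 0 := by
  have h := Nat.card_congr (QuotientGroup.preimageMkEquivSubgroupProdSet A
    (FinGSet.fixedBy B (FinGSet.coset A)))
  rw [mark_cls, ← Nat.cast_mul, ← Nat.card_prod, Finset.sum_boole]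
  refine congrArg Nat.cast (h.symm.trans ?_)
  rw [← Fintype.card_subtype, ← Nat.card_eq_fintype_card]
  refine Nat.card_congr (Equiv.subtypeEquivRight fun g => ?_)
  rw [Subgroup.map_le_iff_le_comap]
  refine forall₂_congr fun b _ => ?_
  have : b • (g : G ⧸ A) = g ↔ g⁻¹ * b * g ∈ A := by
    rw [mul_assoc]
    exact eq_comm.trans QuotientGroup.eq
  refine Iff.trans this ?_
  simp

theorem card_normalizer_smul_burnsideIdempotent [CharZero F] [Fintype (Subgroup G)]
    (A : Subgroup G) :
    (Nat.card (Subgroup.normalizer (A : Set G)) : F) • burnsideIdempotent F A =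
      ∑ B : Subgroup G, ((Nat.card B : F) * (subgroupMoebius B A : F)) • cls F (FinGSet.coset B) := by
  have h0 : (Nat.card (Subgroup.normalizer (A : Set G)) : F) ≠ 0 := by
    exact_mod_cast Nat.card_pos.ne'
  rw [burnsideIdempotent, smul_smul, mul_inv_cancel₀ h0, one_smul]
  refine Finset.sum_subset (Finset.subset_univ _) fun B _ hB => ?_
  rw [subgroupMoebius_eq_zero (by simpa using hB)]
  simp

/-- Möbius inversion: for fixed g, the sum of μ(C, A) over C ≥ g⁻¹Bg detects g⁻¹Bg = A. -/
theorem mark_burnsideIdempotent [CharZero F] [Fintype G] (A B : Subgroup G) :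
    (Nat.card (Subgroup.normalizer (A : Set G)) : F) * mark F B (burnsideIdempotent F A) =
      ∑ g : G, if B.map (MulAut.conj g⁻¹).toMonoidHom = A then (1 : F) else 0 := by
  cases nonempty_fintype (Subgroup G)
  rw [← smul_eq_mul, ← map_smul, card_normalizer_smul_burnsideIdempotent, map_sum]
  calc _ = ∑ C : Subgroup G, ∑ g : G, if B.map (MulAut.conj g⁻¹).toMonoidHom ≤ C then
        (subgroupMoebius C A : F) else 0 := by
        refine Finset.sum_congr rfl fun C _ => ?_
        rw [map_smul, smul_eq_mul, mul_right_comm, card_mul_mark_coset, Finset.sum_mul]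
        simp
    _ = _ := by
        rw [Finset.sum_comm]
        refine Finset.sum_congr rfl fun g _ => ?_
        rw [← Finset.sum_filter]
        exact_mod_cast congrArg (Int.cast : ℤ → F) (sum_subgroupMoebius_left _ A)

theorem mark_burnsideIdempotent_ne_zero_iff [CharZero F] (A B : Subgroup G) :
    mark F B (burnsideIdempotent F A) ≠ 0 ↔
      ∃ g : G, A = B.map (MulAut.conj g).toMonoidHom := by
  cases nonempty_fintype G
  have h0 : (Nat.card (Subgroup.normalizer (A : Set G)) : F) ≠ 0 := by
    exact_mod_cast Nat.card_pos.ne'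
  rw [← mul_ne_zero_iff_right h0, mul_comm, mark_burnsideIdempotent, Finset.sum_boole,
    Nat.cast_ne_zero, ← Nat.pos_iff_ne_zero, Finset.card_pos]
  constructor
  · rintro ⟨g, hg⟩
    exact ⟨g⁻¹, (Finset.mem_filter.1 hg).2.symm⟩
  · rintro ⟨g, hg⟩
    exact ⟨g⁻¹, by simp [hg]⟩

theorem mark_burnsideIdempotent_self_ne_zero [CharZero F] (A : Subgroup G) :
    mark F A (burnsideIdempotent F A) ≠ 0 :=
  (mark_burnsideIdempotent_ne_zero_iff F A A).2 ⟨1, by ext; simp⟩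

/-- The sum runs over subgroups rather than conjugacy classes; the class of A has |G : N(A)|
members, whence the factors. It suffices to treat a transitive X: writing the mark at C as the
number of points x with C ≤ Stab x, Möbius inversion leaves the sum over x of |Stab x| [G / Stab x],
which is |G| [X]. -/
theorem card_smul_eq_sum_mark [CharZero F] [Fintype (Subgroup G)] (α : FBurnside F G) :
    (Nat.card G : F) • α = ∑ A : Subgroup G, mark F A α •
      (Nat.card (Subgroup.normalizer (A : Set G)) : F) • burnsideIdempotent F A := by
  let T : FBurnside F G →ₗ[F] FBurnside F G := ∑ A : Subgroup G, (mark F A).smulRight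
      ((Nat.card (Subgroup.normalizer (A : Set G)) : F) • burnsideIdempotent F A)
  suffices h : α ∈ LinearMap.eqLocus ((Nat.card G : F) • LinearMap.id) T by
    simpa [T, LinearMap.sum_apply] using h
  refine mem_of_cls_coset_mem _ (fun A => ?_) α
  rw [LinearMap.mem_eqLocus]
  let X := FinGSet.coset A
  cases nonempty_fintype X.carrier
  have hX : MulAction.IsPretransitive G X.carrier :=
    inferInstanceAs (MulAction.IsPretransitive G (G ⧸ A))
  have hiso : ∀ x : X.carrier, (FinGSet.coset (MulAction.stabilizer G x)).Iso X := fun x =>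
    ⟨Equiv.ofBijective (MulAction.ofQuotientStabilizer G x)
      ⟨MulAction.injective_ofQuotientStabilizer G x, fun y => by
        obtain ⟨g, rfl⟩ := MulAction.exists_smul_eq G x y
        exact ⟨QuotientGroup.mk g, rfl⟩⟩, MulAction.ofQuotientStabilizer_smul G x⟩
  have hcard : ∀ x : X.carrier,
      Nat.card X.carrier * Nat.card (MulAction.stabilizer G x) = Nat.card G := fun x => by
    rw [← Nat.card_congr (MulAction.orbitProdStabilizerEquivGroup G x), Nat.card_prod,
      MulAction.orbit_eq_univ, Nat.card_univ]
  have hT : T (cls F X) = ∑ B : Subgroup G, ∑ x : X.carrier,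
      if B = MulAction.stabilizer G x then (Nat.card B : F) • cls F (FinGSet.coset B) else 0 := by
    simp only [T, LinearMap.sum_apply, LinearMap.smulRight_apply,
      card_normalizer_smul_burnsideIdempotent, Finset.smul_sum]
    rw [Finset.sum_comm]
    refine Finset.sum_congr rfl fun B _ => ?_
    have hm : ∀ C : Subgroup G, mark F C (cls F X) =
        ∑ x : X.carrier, if C ≤ MulAction.stabilizer G x then (1 : F) else 0 := by
      intro C
      rw [mark_cls, Finset.sum_boole, ← Fintype.card_subtype, ← Nat.card_eq_fintype_card]
      rfl
    calc _ = ∑ x : X.carrier, ∑ C : Subgroup G, if C ≤ MulAction.stabilizer G x then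
          ((Nat.card B : F) * (subgroupMoebius B C : F)) • cls F (FinGSet.coset B) else 0 := by
          rw [Finset.sum_comm]
          refine Finset.sum_congr rfl fun C _ => ?_
          rw [hm, Finset.sum_smul]
          refine Finset.sum_congr rfl fun x _ => ?_
          split_ifs <;> simp
      _ = _ := by
          refine Finset.sum_congr rfl fun x _ => ?_
          rw [← Finset.sum_filter, ← Finset.sum_smul, ← Finset.mul_sum]
          have h := congrArg (Int.cast : ℤ → F)
            (sum_subgroupMoebius_right B (MulAction.stabilizer G x))
          rw [Int.cast_sum] at h
          rw [h]
          split_ifs <;> simp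
  change (Nat.card G : F) • cls F X = T (cls F X)
  rw [hT, Finset.sum_comm]
  simp only [Finset.sum_ite_eq', Finset.mem_univ, if_true]
  have hx0 : Nonempty X.carrier := ⟨(QuotientGroup.mk 1 : G ⧸ A)⟩
  obtain ⟨x0⟩ := hx0
  have hall : ∀ x : X.carrier, (Nat.card (MulAction.stabilizer G x) : F) •
      cls F (FinGSet.coset (MulAction.stabilizer G x)) =
      (Nat.card (MulAction.stabilizer G x0) : F) • cls F X := fun x => by
    rw [cls_eq_of_iso F (hiso x)]
    congr 2
    have : 0 < Nat.card X.carrier := Nat.card_pos_iff.2 ⟨⟨x0⟩, inferInstance⟩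
    exact Nat.eq_of_mul_eq_mul_left this ((hcard x).trans (hcard x0).symm)
  rw [Finset.sum_congr rfl fun x _ => hall x, Finset.sum_const, Finset.card_univ,
    ← Nat.card_eq_fintype_card, ← hcard x0, Nat.cast_mul, mul_smul, Nat.cast_smul_eq_nsmul]

theorem mem_span_burnsideIdempotent [CharZero F] (α : FBurnside F G) :
    α ∈ Submodule.span F
      {e : FBurnside F G | ∃ A : Subgroup G, mark F A α ≠ 0 ∧ e = burnsideIdempotent F A} := by
  cases nonempty_fintype (Subgroup G)
  have h0 : (Nat.card G : F) ≠ 0 := by exact_mod_cast Nat.card_pos.ne'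
  rw [← Submodule.smul_mem_iff _ h0, card_smul_eq_sum_mark]
  refine Submodule.sum_mem _ fun A _ => ?_
  by_cases h : mark F A α = 0
  · rw [h, zero_smul]
    exact Submodule.zero_mem _
  · exact Submodule.smul_mem _ _ (Submodule.smul_mem _ _ (Submodule.subset_span ⟨A, h, rfl⟩))

theorem ext_mark [CharZero F] {α β : FBurnside F G}
    (h : ∀ A : Subgroup G, mark F A α = mark F A β) : α = β := by
  have h1 := mem_span_burnsideIdempotent F (α - β)
  simpa [h, sub_eq_zero] using h1

end FBurnside

end Marks

/-! ### Marks of the image of an idempotent under a biset -/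

section Bisets

open scoped Classical

theorem sum_subgroupMoebius_range {M G : Type u} [Group M] [Finite M] [Group G] [Finite G]
    [Fintype (Subgroup M)] [Fintype (Subgroup G)] {R V : Type*} [Ring R] [AddCommGroup V]
    [Module R V] {i : M →* G} (hi : Function.Injective i) (g : Subgroup G → V) :
    ∑ A : Subgroup G, (subgroupMoebius A i.range : R) • g A =
      ∑ B : Subgroup M, (subgroupMoebius B ⊤ : R) • g (B.map i) := by
  simp only [← subgroupMoebius_map_of_injective hi]
  rw [← Finset.sum_image (f := fun A => (subgroupMoebius A i.range : R) • g A)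
    (g := Subgroup.map i) (fun _ _ _ _ h => Subgroup.map_injective hi h)]
  symm
  refine Finset.sum_subset (Finset.subset_univ _) fun A _ hA => ?_
  rw [subgroupMoebius_eq_zero]
  · simp
  · exact fun h => hA (Finset.mem_image.2 ⟨A.comap i, Finset.mem_univ _,
      by rwa [Subgroup.map_comap_eq, inf_eq_right]⟩)

theorem sum_card_stabilizer_orbit {A V : Type*} [Group A] [Finite A] [MulAction A V] [Fintype V]
    (w : V) :
    ∑ v : V with v ∈ MulAction.orbit A w, Nat.card (MulAction.stabilizer A v) = Nat.card A := by
  have h : ∀ v : V, Nat.card (MulAction.orbit A v) * Nat.card (MulAction.stabilizer A v) =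
      Nat.card A := fun v => by
    rw [← Nat.card_prod, Nat.card_congr (MulAction.orbitProdStabilizerEquivGroup A v)]
  have h' : ∀ v ∈ Finset.univ.filter (· ∈ MulAction.orbit A w),
      Nat.card (MulAction.stabilizer A v) = Nat.card (MulAction.stabilizer A w) := by
    intro v hv
    have hv : v ∈ MulAction.orbit A w := (Finset.mem_filter.1 hv).2
    have h1 := h v
    rw [MulAction.orbit_eq_iff.2 hv, ← h w] at h1
    have : Nonempty (MulAction.orbit A w) := ⟨⟨w, MulAction.mem_orbit_self w⟩⟩
    exact Nat.eq_of_mul_eq_mul_left Nat.card_pos h1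
  rw [Finset.sum_congr rfl h', Finset.sum_const, smul_eq_mul, ← h w, ← Fintype.card_subtype,
    ← Nat.card_eq_fintype_card]

/-- The map p identifies T with the orbit set of V, and the stabilizer orders along each orbit add
up to |A|. -/
theorem card_mul_card_eq_sum_card_stabilizer {A V T : Type*} [Group A] [Finite A] [MulAction A V]
    [Fintype V] [Finite T] {p : V → T} (hs : Function.Surjective p)
    (hp : ∀ v w, p v = p w ↔ v ∈ MulAction.orbit A w) (S : Set T) :
    Nat.card A * Nat.card S =
      ∑ v : V, if p v ∈ S then Nat.card (MulAction.stabilizer A v) else 0 := by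
  cases nonempty_fintype T
  rw [← Finset.sum_filter]
  have h1 : ∀ v ∈ Finset.univ.filter fun v => p v ∈ S,
      p v ∈ Finset.univ.filter fun t => t ∈ S := by simp
  rw [← Finset.sum_fiberwise_of_maps_to h1]
  have h2 : ∀ t ∈ Finset.univ.filter fun t => t ∈ S,
      ∑ v ∈ Finset.univ.filter (fun v => p v ∈ S) with p v = t,
        Nat.card (MulAction.stabilizer A v) = Nat.card A := by
    intro t ht
    have ht : t ∈ S := (Finset.mem_filter.1 ht).2
    obtain ⟨w, rfl⟩ := hs t
    rw [← sum_card_stabilizer_orbit w]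
    refine Finset.sum_congr ?_ fun _ _ => rfl
    ext v
    simp only [Finset.mem_filter, Finset.mem_univ, true_and, ← hp v w]
    exact ⟨fun h => h.2, fun h => ⟨h ▸ ht, h⟩⟩
  rw [Finset.sum_congr rfl h2, Finset.sum_const, smul_eq_mul, mul_comm, ← Fintype.card_subtype,
    ← Nat.card_eq_fintype_card]

namespace FinBiset

/-- The stabilizer of a point of a biset for the right action. -/
def rightStabilizer {P Q : Type u} [Group P] [Group Q] (V : FinBiset Q P) (v : V.carrier) :
    Subgroup P :=
  (MulAction.stabilizer Pᵐᵒᵖ v).unop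

theorem mem_rightStabilizer {P Q : Type u} [Group P] [Group Q] (V : FinBiset Q P)
    {v : V.carrier} {p : P} : p ∈ V.rightStabilizer v ↔ MulOpposite.op p • v = v := Iff.rfl

/-- The subgroup of all `p` such that `v p` lies in the orbit of `v` under a subgroup `Y` acting on
the left. -/
def leftTransporter {P Q : Type u} [Group P] [Group Q] (V : FinBiset Q P) (Y : Subgroup Q)
    (v : V.carrier) : Subgroup P where
  carrier := {p | ∃ y ∈ Y, y • v = MulOpposite.op p • v}
  one_mem' := ⟨1, Y.one_mem, by simp⟩
  mul_mem' := by
    rintro p p' ⟨y, hy, h⟩ ⟨y', hy', h'⟩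
    exact ⟨y * y', Y.mul_mem hy hy', by
      rw [mul_smul, h', smul_comm, h, ← mul_smul, ← MulOpposite.op_mul]⟩
  inv_mem' := by
    rintro p ⟨y, hy, h⟩
    exact ⟨y⁻¹, Y.inv_mem hy, by
      rw [inv_smul_eq_iff, smul_comm, h, ← mul_smul, ← MulOpposite.op_mul]; simp⟩

theorem mk_coset_eq_iff {P Q : Type u} [Group P] [Finite P] [Group Q] (V : FinBiset Q P)
    (A : Subgroup P) (v w : V.carrier) :
    Quotient.mk (tensorSetoid V (FinGSet.coset A)) (v, (QuotientGroup.mk 1 : P ⧸ A)) =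
      Quotient.mk (tensorSetoid V (FinGSet.coset A)) (w, (QuotientGroup.mk 1 : P ⧸ A)) ↔
      ∃ a ∈ A, v = MulOpposite.op a • w := by
  rw [eq_comm]
  refine Quotient.eq.trans ⟨?_, ?_⟩
  · rintro ⟨p, hp⟩
    obtain ⟨h1, h2⟩ := Prod.ext_iff.1 hp
    refine ⟨p, ?_, h1⟩
    have h3 : (QuotientGroup.mk 1 : P ⧸ A) = QuotientGroup.mk (p⁻¹ * 1) := h2
    simpa using QuotientGroup.eq.1 h3
  · rintro ⟨a, ha, rfl⟩
    refine ⟨a, Prod.ext rfl ?_⟩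
    change (QuotientGroup.mk 1 : P ⧸ A) = QuotientGroup.mk (a⁻¹ * 1)
    exact QuotientGroup.eq.2 (by simpa)

/-- V ×_P (P / A) is V / A. Weighting points by stabilizers turns the count of fixed orbits into a
sum over V, an index set independent of A, so that the sum over A can be taken pointwise. -/
theorem card_mul_mark_tensor_coset (F : Type v) [Field F] {P Q : Type u} [Group P] [Finite P]
    [Group Q] (V : FinBiset Q P) [Fintype V.carrier] (A : Subgroup P) (Y : Subgroup Q) :
    (Nat.card A : F) * FBurnside.mark F Y (V.onFBurnside F (FBurnside.cls F (FinGSet.coset A))) =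
      ((∑ v : V.carrier, if ∀ y ∈ Y, ∃ a ∈ A, y • v = MulOpposite.op a • v then
        Nat.card (A ⊓ V.rightStabilizer v : Subgroup P) else 0 : ℕ) : F) := by
  rw [onFBurnside_cls, FBurnside.mark_cls, ← Nat.cast_mul]
  congr 1
  have hfin : Finite A.op := Finite.of_equiv A A.equivOp
  have h := card_mul_card_eq_sum_card_stabilizer (A := A.op) (V := V.carrier)
    (T := (V.tensor (FinGSet.coset A)).carrier)
    (p := fun v => Quotient.mk (tensorSetoid V (FinGSet.coset A)) (v, (QuotientGroup.mk 1 : P ⧸ A)))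
    (by
      rintro ⟨v, x⟩
      induction x using QuotientGroup.induction_on with
      | _ p =>
        refine ⟨MulOpposite.op p • v, Quotient.sound ?_⟩
        refine ⟨p⁻¹, Prod.ext ?_ ?_⟩
        · simp [← mul_smul]
        · change (QuotientGroup.mk p : P ⧸ A) = QuotientGroup.mk (p⁻¹⁻¹ * 1)
          simp)
    (fun v w => (mk_coset_eq_iff V A v w).trans
      ⟨by rintro ⟨a, ha, rfl⟩; exact ⟨⟨MulOpposite.op a, ha⟩, rfl⟩,
        by rintro ⟨⟨a, ha⟩, rfl⟩; exact ⟨a.unop, ha, rfl⟩⟩)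
    ((V.tensor (FinGSet.coset A)).fixedBy Y)
  rw [← Nat.card_congr A.equivOp] at h
  rw [h]
  refine Finset.sum_congr rfl fun v _ => ?_
  refine if_congr (forall₂_congr fun y _ => mk_coset_eq_iff V A (y • v) v) ?_ rfl
  exact Nat.card_congr
    { toFun := fun a => ⟨a.1.1.unop, a.1.2, a.2⟩
      invFun := fun a => ⟨⟨MulOpposite.op a.1, a.2.1⟩, a.2.2⟩
      left_inv := fun _ => rfl
      right_inv := fun _ => rfl }

/-- If vx = yv and vn = v, then v(xnx⁻¹) = y(vn)x⁻¹ = (yv)x⁻¹ = v. -/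
theorem rightStabilizer_normal {P Q : Type u} [Group P] [Group Q] (V : FinBiset Q P)
    {X : Subgroup P} {Y : Subgroup Q} {v : V.carrier} (hX : X ≤ V.leftTransporter Y v) :
    ((V.rightStabilizer v).subgroupOf X).Normal := by
  refine ⟨fun n hn x => ?_⟩
  rw [Subgroup.mem_subgroupOf, mem_rightStabilizer] at hn ⊢
  obtain ⟨y, -, hy⟩ := hX x.2
  have h1 : MulOpposite.op (x : P)⁻¹ • v = y⁻¹ • v := by
    rw [eq_inv_smul_iff, smul_comm, hy, ← mul_smul, ← MulOpposite.op_mul]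
    simp
  have h2 : MulOpposite.op ((x * n * x⁻¹ : X) : P) =
      MulOpposite.op (x : P)⁻¹ * (MulOpposite.op (n : P) * MulOpposite.op (x : P)) := by
    simp [mul_assoc]
  rw [h2, mul_smul, mul_smul, ← hy, ← smul_comm y, hn, ← smul_comm y, h1, smul_inv_smul]

/-- This isolates the contribution of one point v. When Yv = vX, with R the stabilizer of v in X, it
equals |R| m_{X,R}; otherwise it vanishes. -/
theorem sum_subgroupMoebius_fixed {P Q : Type u} [Group P] [Finite P] [Group Q]
    [Fintype (Subgroup P)] (V : FinBiset Q P) (X : Subgroup P) (Y : Subgroup Q) (v : V.carrier)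
    (h : ∑ A : Subgroup P, (subgroupMoebius A X : ℚ) •
      (if ∀ y ∈ Y, ∃ a ∈ A, y • v = MulOpposite.op a • v then
        (Nat.card (A ⊓ V.rightStabilizer v : Subgroup P) : ℚ) else 0) ≠ 0) :
    X ≤ V.leftTransporter Y v ∧ (∀ y ∈ Y, ∃ x ∈ X, y • v = MulOpposite.op x • v) ∧
      mInvariant ((V.rightStabilizer v).subgroupOf X) ≠ 0 := by
  cases nonempty_fintype (Subgroup X)
  have hX : X ≤ V.leftTransporter Y v := by
    by_contra hX
    -- Only the elements of A in the transporter enter the condition and the count, so Weisner's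
    -- theorem applies unless X lies in the transporter.
    refine h (Eq.trans (Finset.sum_congr rfl fun A _ => ?_)
      (sum_subgroupMoebius_mul_inf_eq_zero hX fun A =>
        if ∀ y ∈ Y, ∃ a ∈ A, y • v = MulOpposite.op a • v then
          (Nat.card (A ⊓ V.rightStabilizer v : Subgroup P) : ℚ) else 0))
    rw [smul_eq_mul]
    congr 1
    refine if_congr (forall₂_congr fun y hy => exists_congr fun a => ?_) ?_ rfl
    · exact ⟨fun h => ⟨⟨h.1, y, hy, h.2⟩, h.2⟩, fun h => ⟨h.1.1, h.2⟩⟩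
    · have : V.rightStabilizer v ≤ V.leftTransporter Y v := fun p hp =>
        ⟨1, Y.one_mem, by rw [one_smul]; exact (V.mem_rightStabilizer.1 hp).symm⟩
      rw [inf_assoc, inf_eq_right.2 this]
  have hY : ∀ y ∈ Y, ∃ x ∈ X, y • v = MulOpposite.op x • v := by
    by_contra hY
    refine h (Finset.sum_eq_zero fun A _ => ?_)
    by_cases hA : A ≤ X
    · rw [if_neg, smul_zero]
      refine fun hA' => hY fun y hy => ?_
      obtain ⟨a, ha, h⟩ := hA' y hy
      exact ⟨a, hA ha, h⟩
    · rw [subgroupMoebius_eq_zero hA, Int.cast_zero, zero_smul]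
  refine ⟨hX, hY, fun hm => h ?_⟩
  have hn := V.rightStabilizer_normal hX
  have hs := sum_subgroupMoebius_range (R := ℚ) (i := X.subtype) X.subtype_injective fun A =>
    if ∀ y ∈ Y, ∃ a ∈ A, y • v = MulOpposite.op a • v then
      (Nat.card (A ⊓ V.rightStabilizer v : Subgroup P) : ℚ) else 0
  rw [Subgroup.range_subtype] at hs
  rw [hs]
  have hc := card_mul_mInvariant ((V.rightStabilizer v).subgroupOf X)
  rw [hm, mul_zero, Finset.sum_filter] at hc
  refine Eq.trans (Finset.sum_congr rfl fun B _ => ?_) hc.symm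
  -- Since Yv = vX, the condition on B reads vB = vX, that is BR = X.
  have hiff : (∀ y ∈ Y, ∃ a ∈ B.map X.subtype, y • v = MulOpposite.op a • v) ↔
      B ⊔ (V.rightStabilizer v).subgroupOf X = ⊤ := by
    rw [eq_top_iff]
    constructor
    · rintro hB x -
      obtain ⟨y, hy, hx⟩ := hX x.2
      obtain ⟨_, ⟨b, hb, rfl⟩, hb'⟩ := hB y hy
      rw [sup_comm]
      refine Subgroup.mem_sup_of_normal_left.2 ⟨x * b⁻¹, ?_, b, hb, by simp⟩
      rw [Subgroup.mem_subgroupOf, mem_rightStabilizer, Subgroup.coe_mul, MulOpposite.op_mul,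
        mul_smul, ← hx, hb', ← mul_smul, ← MulOpposite.op_mul]
      simp
    · intro hB y hy
      obtain ⟨x, hx, hxy⟩ := hY y hy
      have hx' := hB (Subgroup.mem_top ⟨x, hx⟩)
      rw [sup_comm] at hx'
      obtain ⟨n, hn', b, hb, hnb⟩ := Subgroup.mem_sup_of_normal_left.1 hx'
      refine ⟨b, ⟨b, hb, rfl⟩, ?_⟩
      have hx2 : x = n * b := congrArg Subtype.val hnb.symm
      rw [Subgroup.mem_subgroupOf, mem_rightStabilizer] at hn'
      rw [hxy, hx2, MulOpposite.op_mul, mul_smul, hn']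
  have hcard : Nat.card (B.map X.subtype ⊓ V.rightStabilizer v : Subgroup P) =
      Nat.card (B ⊓ (V.rightStabilizer v).subgroupOf X : Subgroup X) := by
    rw [← Subgroup.card_map_of_injective (K := B ⊓ (V.rightStabilizer v).subgroupOf X)
      X.subtype_injective]
    congr 2
    ext p
    constructor
    · rintro ⟨⟨b, hb, rfl⟩, hp⟩
      exact ⟨b, ⟨hb, hp⟩, rfl⟩
    · rintro ⟨b, ⟨hb, hp⟩, rfl⟩
      exact ⟨⟨b, hb, rfl⟩, hp⟩
  simp only [hiff, hcard]
  split_ifs <;> simp [mul_comm]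

theorem exists_of_mark_onFBurnside_ne_zero (F : Type v) [Field F] [CharZero F] {P Q : Type u}
    [Group P] [Finite P] [Group Q] (V : FinBiset Q P) (X : Subgroup P) (Y : Subgroup Q)
    (h : FBurnside.mark F Y (V.onFBurnside F (burnsideIdempotent F X)) ≠ 0) :
    ∃ v : V.carrier, X ≤ V.leftTransporter Y v ∧
      (∀ y ∈ Y, ∃ x ∈ X, y • v = MulOpposite.op x • v) ∧
      mInvariant ((V.rightStabilizer v).subgroupOf X) ≠ 0 := by
  cases nonempty_fintype V.carrier
  cases nonempty_fintype (Subgroup P)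
  have h0 : (Nat.card (Subgroup.normalizer (X : Set P)) : F) ≠ 0 := by
    exact_mod_cast Nat.card_pos.ne'
  rw [← mul_ne_zero_iff_left h0, ← smul_eq_mul, ← map_smul, ← map_smul,
    FBurnside.card_normalizer_smul_burnsideIdempotent] at h
  -- The mark is the image in F of a rational number, so non-vanishing can be tested in ℚ, where the
  -- invariants m live.
  have key : FBurnside.mark F Y (V.onFBurnside F (∑ A : Subgroup P,
      ((Nat.card A : F) * (subgroupMoebius A X : F)) • FBurnside.cls F (FinGSet.coset A))) =
      ((∑ v : V.carrier, ∑ A : Subgroup P, (subgroupMoebius A X : ℚ) •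
      (if ∀ y ∈ Y, ∃ a ∈ A, y • v = MulOpposite.op a • v then
        (Nat.card (A ⊓ V.rightStabilizer v : Subgroup P) : ℚ) else 0) : ℚ) : F) := by
    rw [Finset.sum_comm]
    simp only [map_sum, map_smul, smul_eq_mul]
    rw [Rat.cast_sum]
    refine Finset.sum_congr rfl fun A _ => ?_
    rw [mul_right_comm, card_mul_mark_tensor_coset, ← Finset.mul_sum, mul_comm]
    push_cast
    simp only [apply_ite (Rat.cast : ℚ → F), Rat.cast_natCast, Rat.cast_zero]
  rw [key, Rat.cast_ne_zero] at h
  obtain ⟨v, -, hv⟩ := Finset.exists_ne_zero_of_sum_ne_zero h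
  exact ⟨v, V.sum_subgroupMoebius_fixed X Y v hv⟩

end FinBiset

/-- A non-zero mark supplies v with Yv = vX and m_{X,R} ≠ 0. Since K acts freely on the second
factor, R ≤ Ker p₂, so some surjection f : X → L kills R. The relation yv = vx determines x up to R,
and y ↦ f(x) is the required map. -/
theorem hasQuotientOver_of_mark_mapBiset_ne_zero {F : Type v} [Field F] [CharZero F]
    {G H K L : Type u} [Group G] [Finite G] [Group H] [Finite H] [Group K] [Finite K] [Group L]
    [Finite L] {φ : L →* K} (hφ : IsRelativeBGroup φ) (U : FinBiset H G) {X : Subgroup (G × K)}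
    (hX : HasQuotientOver (subgroupSnd X) φ) {Y : Subgroup (H × K)}
    (h : FBurnside.mark F Y (ShiftedBurnside.mapBiset F K U (burnsideIdempotent F X)) ≠ 0) :
    HasQuotientOver (subgroupSnd Y) φ := by
  obtain ⟨v, hXv, hYv, hm⟩ := (U.shift K).exists_of_mark_onFBurnside_ne_zero F X Y h
  have hn := (U.shift K).rightStabilizer_normal hXv
  have hsnd : ∀ p : G × K, (MulOpposite.op p • v : (U.shift K).carrier).2 = v.2 * p.2 :=
    fun _ => rfl
  obtain ⟨f, hf, hker, k, hk⟩ := exists_quotient_of_mInvariant_ne_zero hφ _ rfl hX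
    (N := ((U.shift K).rightStabilizer v).subgroupOf X) (fun x hx => by
      have h1 := congrArg Prod.snd ((U.shift K).mem_rightStabilizer.1 (Subgroup.mem_subgroupOf.1 hx))
      rw [hsnd] at h1
      exact mul_eq_left.1 h1) hm
  obtain ⟨g, hg⟩ := exists_monoidHom_of_relation
    (fun (y : Y) (x : X) => (y : H × K) • v = MulOpposite.op (x : G × K) • v)
    (fun y => by
      obtain ⟨x, hx, h⟩ := hYv y y.2
      exact ⟨⟨x, hx⟩, h⟩)
    (fun a b a' b' h h' => by
      rw [Subgroup.coe_mul, Subgroup.coe_mul, mul_smul, h', smul_comm, h, ← mul_smul,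
        ← MulOpposite.op_mul])
    f
    (fun y x x' h h' => by
      have h1 : x' * x⁻¹ ∈ f.ker := hker (by
        rw [Subgroup.mem_subgroupOf, FinBiset.mem_rightStabilizer, Subgroup.coe_mul,
          MulOpposite.op_mul, mul_smul, ← h', h, ← mul_smul, ← MulOpposite.op_mul]
        simp)
      rw [MonoidHom.mem_ker, map_mul, map_inv, mul_inv_eq_one] at h1
      exact h1.symm)
  -- With t the K-component of v, yv = vx reads p₂(y) = t p₂(x) t⁻¹; conjugation by kt⁻¹ undoes this
  -- and then applies k.
  refine ⟨g, fun l => ?_, k * v.2⁻¹, fun y => ?_⟩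
  · obtain ⟨x, rfl⟩ := hf l
    obtain ⟨y, hy, h⟩ := hXv x.2
    exact ⟨⟨y, hy⟩, hg ⟨y, hy⟩ x h⟩
  · obtain ⟨x, hx, h⟩ := hYv y y.2
    rw [hg y ⟨x, hx⟩ h, ← hk]
    have h1 : (y : H × K).2 * v.2 = v.2 * x.2 := congrArg Prod.snd h
    have h2 : (y : H × K).2 = v.2 * x.2 * v.2⁻¹ := eq_mul_inv_of_mul_eq h1
    have h3 : subgroupSnd Y y = (y : H × K).2 := rfl
    have h4 : subgroupSnd X ⟨x, hx⟩ = x.2 := rfl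
    rw [h3, h4, h2, MulAut.conj_apply, MulAut.conj_apply]
    group

/-- For a homomorphism `f : G → H`, the set `H` as a `(G, H)`-biset. -/
def FinBiset.res {G H : Type u} [Group G] [Group H] [Finite H] (f : G →* H) : FinBiset G H where
  carrier := H
  leftAction := MulAction.compHom H f
  smulComm := by
    let _ := MulAction.compHom H f
    exact ⟨fun g h a => smul_comm (f g) h a⟩

/-- For a homomorphism `f : G → H`, the set `H` as an `(H, G)`-biset. -/
def FinBiset.ind {G H : Type u} [Group G] [Group H] [Finite H] (f : G →* H) : FinBiset H G where
  carrier := H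
  rightAction := MulAction.compHom H f.op
  smulComm := by
    let _ := MulAction.compHom H f.op
    exact ⟨fun h g a => smul_comm h (MulOpposite.op (f g.unop)) a⟩

theorem FinBiset.tensor_shift_res_iso {G H K : Type u} [Group G] [Group H] [Finite H] [Group K]
    [Finite K] (f : G →* H) (Z : FinGSet (H × K)) :
    (((FinBiset.res f).shift K).tensor Z).Iso (Z.pullback (f.prodMap (MonoidHom.id K))) := by
  -- The identity, used to view points of the biset as elements of the group H × K.
  let r : ((FinBiset.res f).shift K).carrier → H × K := id
  refine ⟨
    { toFun := Quotient.lift (fun a => (r a.1 • (a.2 : Z.carrier) : Z.carrier)) ?_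
      invFun := fun z => Quotient.mk _ ((1 : H × K), z)
      left_inv := ?_
      right_inv := fun z => one_smul (H × K) (show Z.carrier from z) }, ?_⟩
  · rintro a _ ⟨p, rfl⟩
    change r a.1 • (a.2 : Z.carrier) = (r a.1 * p) • p⁻¹ • (a.2 : Z.carrier)
    rw [mul_smul, smul_inv_smul]
  · rintro ⟨a, z⟩
    refine Quotient.sound ⟨(r a), Prod.ext ?_ (inv_smul_smul (r a) (show Z.carrier from z)).symm⟩
    exact (one_mul (r a)).symm
  · rintro g ⟨a, z⟩
    exact mul_smul ((f g.1, g.2) : H × K) (r a) (show Z.carrier from z)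

/-- With h = f × id, the isomorphism sends the class of (v, xA) to v h(x) h(A). Injectivity is
checked on representatives (v, A), which exist in every class. -/
theorem FinBiset.tensor_shift_ind_coset_iso {G H K : Type u} [Group G] [Finite G] [Group H]
    [Finite H] [Group K] [Finite K] (f : G →* H) (A : Subgroup (G × K)) :
    (((FinBiset.ind f).shift K).tensor (FinGSet.coset A)).Iso
      (FinGSet.coset (A.map (f.prodMap (MonoidHom.id K)))) := by
  set h := f.prodMap (MonoidHom.id K) with hh
  let r : ((FinBiset.ind f).shift K).carrier → H × K := id
  let c : (G × K) ⧸ A → (H × K) ⧸ A.map h := Quotient.map' h (by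
    intro a b hab
    rw [QuotientGroup.leftRel_apply] at hab ⊢
    rw [← map_inv, ← map_mul]
    exact Subgroup.mem_map_of_mem h hab)
  have hc : ∀ (p : G × K) (x : (G × K) ⧸ A), c (p • x) = h p • c x := by
    rintro p ⟨x⟩
    change (QuotientGroup.mk (h (p * x)) : (H × K) ⧸ A.map h) = QuotientGroup.mk (h p * h x)
    rw [map_mul]
  let T : ((FinBiset.ind f).shift K).carrier × (FinGSet.coset A).carrier → (H × K) ⧸ A.map h :=
    fun a => r a.1 • c a.2
  have hT : ∀ a b, (FinBiset.tensorSetoid ((FinBiset.ind f).shift K) (FinGSet.coset A)).r a b →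
      T a = T b := by
    rintro a _ ⟨p, rfl⟩
    have key : ∀ (v : H × K) (x : (G × K) ⧸ A), v • c x = (v * h p) • c (p⁻¹ • x) := by
      intro v x
      rw [hc, map_inv, mul_smul, smul_inv_smul]
    exact key (r a.1) a.2
  refine ⟨Equiv.ofBijective (Quotient.lift T hT) ⟨?_, ?_⟩, ?_⟩
  · have hsurj : ∀ t : (((FinBiset.ind f).shift K).tensor (FinGSet.coset A)).carrier,
        ∃ v : H × K, t = Quotient.mk (FinBiset.tensorSetoid ((FinBiset.ind f).shift K)
          (FinGSet.coset A)) (v, (QuotientGroup.mk 1 : (G × K) ⧸ A)) := by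
      rintro ⟨v, x⟩
      induction x using QuotientGroup.induction_on with
      | _ p =>
        refine ⟨r v * h p, Quotient.sound ⟨p, Prod.ext rfl ?_⟩⟩
        change (QuotientGroup.mk 1 : (G × K) ⧸ A) = QuotientGroup.mk (p⁻¹ * p)
        rw [inv_mul_cancel]
    intro s t hst
    obtain ⟨v, rfl⟩ := hsurj s
    obtain ⟨w, rfl⟩ := hsurj t
    have h1 : (QuotientGroup.mk (w * h 1) : (H × K) ⧸ A.map h) = QuotientGroup.mk (v * h 1) :=
      Eq.symm hst
    rw [QuotientGroup.eq, map_one, mul_one, mul_one] at h1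
    obtain ⟨a, ha, hav⟩ := h1
    refine (FinBiset.mk_coset_eq_iff ((FinBiset.ind f).shift K) A v w).2 ⟨a, ha, ?_⟩
    exact (eq_mul_of_inv_mul_eq hav.symm : v = w * h a)
  · rintro ⟨q⟩
    refine ⟨Quotient.mk _ ((q : H × K), (QuotientGroup.mk 1 : (G × K) ⧸ A)), ?_⟩
    change (QuotientGroup.mk (q * h 1) : (H × K) ⧸ A.map h) = QuotientGroup.mk q
    rw [map_one, mul_one]
  · rintro q ⟨v, x⟩
    exact mul_smul q (r v) (c x)

namespace ShiftedBurnside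

variable (F : Type v) [Field F] {G H K : Type u} [Group G] [Group H] [Finite H] [Group K] [Finite K]

theorem mapBiset_res (f : G →* H) (α : ShiftedBurnside F K H) :
    mapBiset F K (FinBiset.res f) α =
      FBurnside.pullback F (f.prodMap (MonoidHom.id K)) α := by
  refine DFunLike.congr_fun (FBurnside.linearMap_ext fun Z => ?_) α
  rw [mapBiset, FinBiset.onFBurnside_cls, FBurnside.pullback_cls]
  exact FBurnside.cls_eq_of_iso F (FinBiset.tensor_shift_res_iso f Z)

theorem mapBiset_ind_cls_coset [Finite G] (f : G →* H) (A : Subgroup (G × K)) :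
    mapBiset F K (FinBiset.ind f) (FBurnside.cls F (FinGSet.coset A)) =
      FBurnside.cls F (FinGSet.coset (A.map (f.prodMap (MonoidHom.id K)))) := by
  rw [mapBiset, FinBiset.onFBurnside_cls]
  exact FBurnside.cls_eq_of_iso F (FinBiset.tensor_shift_ind_coset_iso f A)

end ShiftedBurnside

end Bisets

/-! ### Ideals and the two inclusions -/

section Ideals

theorem HasQuotientOver.trans {K M N L : Type u} [Group K] [Group M] [Group N] [Group L]
    {ψ : M →* K} {χ : N →* K} {φ : L →* K} (h : HasQuotientOver ψ χ) (h' : HasQuotientOver χ φ) :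
    HasQuotientOver ψ φ := by
  obtain ⟨f, hf, k, hk⟩ := h
  obtain ⟨f', hf', k', hk'⟩ := h'
  refine ⟨f'.comp f, hf'.comp hf, k' * k, fun m => ?_⟩
  rw [map_mul, MulAut.mul_apply, hk, hk']
  rfl

theorem hasQuotientOver_subgroupSnd_map {G H K : Type u} [Group G] [Group H] [Group K]
    (f : G × K →* H × K) (k : K) (hf : ∀ x, MulAut.conj k x.2 = (f x).2) (X : Subgroup (G × K)) :
    HasQuotientOver (subgroupSnd X) (subgroupSnd (X.map f)) :=
  ⟨f.subgroupMap X, f.subgroupMap_surjective X, k, fun x => hf x⟩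

theorem hasQuotientOver_subgroupSnd_graph {K M : Type u} [Group K] [Group M] (ψ : M →* K) :
    HasQuotientOver ψ (subgroupSnd ψ.graph) :=
  ⟨((MonoidHom.id M).prod ψ).codRestrict ψ.graph fun _ => rfl,
    fun ⟨x, hx⟩ => ⟨x.1, Subtype.ext (Prod.ext rfl hx)⟩, 1, fun m => by simp; rfl⟩

theorem subgroupSnd_graph_hasQuotientOver {K M : Type u} [Group K] [Group M] (ψ : M →* K) :
    HasQuotientOver (subgroupSnd ψ.graph) ψ :=
  ⟨(MonoidHom.fst M K).comp ψ.graph.subtype, fun m => ⟨⟨(m, ψ m), rfl⟩, rfl⟩, 1, fun x => by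
    rw [map_one]
    exact (MonoidHom.mem_graph.1 x.2).symm⟩

theorem ShiftedBurnside.mark_mul (F : Type v) [Field F] {G H K : Type u} [Group G] [Group H]
    [Group K] (X : Subgroup ((G × H) × K)) (α : ShiftedBurnside F K G)
    (β : ShiftedBurnside F K H) :
    FBurnside.mark F X (mul F K α β) =
      FBurnside.mark F (X.map ((MonoidHom.fst G H).prodMap (MonoidHom.id K))) α *
        FBurnside.mark F (X.map ((MonoidHom.snd G H).prodMap (MonoidHom.id K))) β := by
  rw [mul, FBurnside.mark_pullback, FBurnside.mark_prod, Subgroup.map_map, Subgroup.map_map]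
  rfl

/-- The ideal of all elements whose marks vanish at the subgroups that do not have `(L, φ)` as a
quotient over `K`. -/
noncomputable def quotientIdeal (F : Type v) [Field F] [CharZero F] {K L : Type u} [Group K]
    [Finite K] [Group L] [Finite L] {φ : L →* K} (hφ : IsRelativeBGroup φ) :
    ShiftedBurnsideIdeal F K where
  eval G _ _ :=
    { carrier := {α | ∀ X : Subgroup (G × K), FBurnside.mark F X α ≠ 0 →
        HasQuotientOver (subgroupSnd X) φ}
      zero_mem' := fun X h => (h (map_zero _)).elim
      add_mem' := by
        intro α β hα hβ X h
        by_contra hX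
        exact h (by rw [map_add, not_not.1 (mt (hα X) hX), not_not.1 (mt (hβ X) hX), add_zero])
      smul_mem' := by
        intro r α hα X h
        exact hα X fun h0 => h (by rw [map_smul, h0, smul_zero]) }
  map_mem {G H} _ _ _ _ U α hα Y hY := by
    -- By linearity it suffices to treat the idempotents e_A with A in the support of α, all of
    -- which have (L, φ) as a quotient.
    have h1 := FBurnside.mem_span_burnsideIdempotent F α
    by_contra hn
    refine hY ?_
    have h2 : Submodule.span F {e : FBurnside F (G × K) | ∃ A : Subgroup (G × K),
        FBurnside.mark F A α ≠ 0 ∧ e = burnsideIdempotent F A} ≤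
        LinearMap.ker ((FBurnside.mark F Y).comp (ShiftedBurnside.mapBiset F K U)) := by
      rw [Submodule.span_le]
      rintro _ ⟨A, hA, rfl⟩
      by_contra h
      exact hn (hasQuotientOver_of_mark_mapBiset_ne_zero hφ U (hα A hA) h)
    exact h2 h1
  mul_mem {G H} _ _ _ _ α β hβ X hX := by
    -- The mark of the product has as a factor the mark of β at the projection of X to H × K, which
    -- is a quotient of X over K.
    rw [ShiftedBurnside.mark_mul] at hX
    exact (hasQuotientOver_subgroupSnd_map _ 1 (fun x => by simp) X).trans
      (hβ _ (right_ne_zero_of_mul hX))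

theorem quotientIdeal_eval (F : Type v) [Field F] [CharZero F] {K L : Type u} [Group K]
    [Finite K] [Group L] [Finite L] {φ : L →* K} (hφ : IsRelativeBGroup φ) (G : Type u) [Group G]
    [Finite G] :
    (quotientIdeal F hφ).eval G =
      Submodule.span F {e : ShiftedBurnside F K G | ∃ X : Subgroup (G × K),
        HasQuotientOver (subgroupSnd X) φ ∧ e = burnsideIdempotent F X} := by
  apply le_antisymm
  · intro α hα
    refine Submodule.span_mono ?_ (FBurnside.mem_span_burnsideIdempotent F α)
    rintro _ ⟨X, hX, rfl⟩
    exact ⟨X, hα X hX, rfl⟩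
  · rw [Submodule.span_le]
    rintro _ ⟨X, hX, rfl⟩ Y hY
    -- Y is conjugate to X by g, which changes p₂ by the inner automorphism attached to the
    -- K-component of g.
    obtain ⟨g, rfl⟩ := (FBurnside.mark_burnsideIdempotent_ne_zero_iff F X Y).1 hY
    exact (hasQuotientOver_subgroupSnd_map (MulAut.conj g).toMonoidHom g.2 (fun x => rfl) Y).trans
      hX

namespace ShiftedBurnsideIdeal

variable {F : Type v} [Field F] {K : Type u} [Group K] [Finite K]

theorem mem_generatedBy {L : Type u} [Group L] [Finite L] (a : ShiftedBurnside F K L) :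
    a ∈ (generatedBy a).eval L := by
  simp only [generatedBy, Submodule.mem_iInf]
  exact fun I hI => hI

theorem generatedBy_le {L : Type u} [Group L] [Finite L] {a : ShiftedBurnside F K L}
    {I : ShiftedBurnsideIdeal F K} (h : a ∈ I.eval L) : generatedBy a ≤ I := by
  intro G _ _
  exact iInf₂_le (f := fun (I : ShiftedBurnsideIdeal F K) (_ : a ∈ I.eval L) => I.eval G) I h

variable [CharZero F]

/-- Multiplying by e_X and restricting along the diagonal G → G × G multiplies marks pointwise. The
result is mark_X(α) e_X, with an invertible scalar. -/
theorem burnsideIdempotent_mem (I : ShiftedBurnsideIdeal F K) {G : Type u} [Group G] [Finite G]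
    {α : ShiftedBurnside F K G} (hα : α ∈ I.eval G) {X : Subgroup (G × K)}
    (hX : FBurnside.mark F X α ≠ 0) : burnsideIdempotent F X ∈ I.eval G := by
  have h1 := I.map_mem (FinBiset.res ((MonoidHom.id G).prod (MonoidHom.id G)))
    (I.mul_mem (burnsideIdempotent F X : ShiftedBurnside F K G) hα)
  rw [ShiftedBurnside.mapBiset_res] at h1
  rw [← Submodule.smul_mem_iff _ hX]
  convert h1 using 1
  refine FBurnside.ext_mark F fun Y => ?_
  have hid : ∀ f : (G × K) →* (G × K), (∀ x, f x = x) → Y.map f = Y := fun f hf => by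
    rw [show f = MonoidHom.id _ from MonoidHom.ext hf, Subgroup.map_id]
  rw [FBurnside.mark_pullback, ShiftedBurnside.mark_mul, Subgroup.map_map, Subgroup.map_map,
    hid _ fun _ => rfl, hid _ fun _ => rfl, map_smul, smul_eq_mul]
  by_cases h0 : FBurnside.mark F Y (burnsideIdempotent F X) = 0
  · rw [h0, mul_zero, zero_mul]
  · obtain ⟨g, rfl⟩ := (FBurnside.mark_burnsideIdempotent_ne_zero_iff F X Y).1 h0
    rw [FBurnside.mark_conj, mul_comm]

end ShiftedBurnsideIdeal

theorem card_normalizer_smul_burnsideIdempotent_range (F : Type v) [Field F] [CharZero F]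
    {M G : Type u} [Group M] [Finite M] [Group G] [Finite G] [Fintype (Subgroup M)]
    {i : M →* G} (hi : Function.Injective i) :
    (Nat.card (Subgroup.normalizer (i.range : Set G)) : F) • burnsideIdempotent F i.range =
      ∑ B : Subgroup M, (subgroupMoebius B ⊤ : F) • (Nat.card B : F) •
        FBurnside.cls F (FinGSet.coset (B.map i)) := by
  cases nonempty_fintype (Subgroup G)
  rw [FBurnside.card_normalizer_smul_burnsideIdempotent]
  simp only [mul_comm (Nat.card _ : F), mul_smul]
  rw [sum_subgroupMoebius_range hi]
  simp only [Subgroup.card_map_of_injective hi]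

/-- Induction sends the class of a coset space to that of the image subgroup. Injectivity of (j, χ)
makes j × id injective on the graph, so orders and Möbius values are preserved and only the
normalizers differ. -/
theorem mapBiset_ind_burnsideIdempotent_graph (F : Type v) [Field F] [CharZero F]
    {M G K : Type u} [Group M] [Finite M] [Group G] [Finite G] [Group K] [Finite K]
    (j : M →* G) (χ : M →* K) (h : Function.Injective (j.prod χ)) :
    (Nat.card (Subgroup.normalizer (χ.graph : Set (M × K))) : F) •
        ShiftedBurnside.mapBiset F K (FinBiset.ind j) (burnsideIdempotent F χ.graph) =
      (Nat.card (Subgroup.normalizer ((j.prod χ).range : Set (G × K))) : F) •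
        burnsideIdempotent F (j.prod χ).range := by
  cases nonempty_fintype (Subgroup M)
  have hi : Function.Injective ((MonoidHom.id M).prod χ) := fun a b hab =>
    congrArg Prod.fst hab
  rw [← map_smul, MonoidHom.graph_eq_range_prod, card_normalizer_smul_burnsideIdempotent_range F hi,
    card_normalizer_smul_burnsideIdempotent_range F h, map_sum]
  refine Finset.sum_congr rfl fun B _ => ?_
  rw [map_smul, map_smul, ShiftedBurnside.mapBiset_ind_cls_coset, Subgroup.map_map]
  rfl

theorem burnsideIdempotent_mem_idempotentIdeal (F : Type v) [Field F] [CharZero F]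
    {K L G : Type u} [Group K] [Finite K] [Group L] [Finite L] [Group G] [Finite G] {φ : L →* K}
    {X : Subgroup (G × K)} (hX : HasQuotientOver (subgroupSnd X) φ) :
    burnsideIdempotent F X ∈ (idempotentIdeal F φ).eval G := by
  obtain ⟨f, hf, k, hk⟩ := hX
  have h1 := (idempotentIdeal F φ).map_mem (FinBiset.res f)
    (ShiftedBurnsideIdeal.mem_generatedBy (burnsideIdempotent F φ.graph : ShiftedBurnside F K L))
  rw [ShiftedBurnside.mapBiset_res] at h1
  -- f × id maps the graph of φ ∘ f onto that of φ, so the restricted element has a non-zero mark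
  -- there.
  have h2 : burnsideIdempotent F (φ.comp f).graph ∈ (idempotentIdeal F φ).eval X := by
    refine ShiftedBurnsideIdeal.burnsideIdempotent_mem _ h1 ?_
    rw [FBurnside.mark_pullback]
    have : (φ.comp f).graph.map (f.prodMap (MonoidHom.id K)) = φ.graph := by
      ext ⟨l, c⟩
      constructor
      · rintro ⟨⟨x, d⟩, hx, h⟩
        obtain ⟨rfl, rfl⟩ := Prod.ext_iff.1 h
        exact hx
      · intro hl
        obtain ⟨x, rfl⟩ := hf l
        exact ⟨(x, c), hl, rfl⟩
    rw [this]
    exact FBurnside.mark_burnsideIdempotent_self_ne_zero F _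
  -- The map j need not be injective, but (j, φ ∘ f) is: it is the inclusion of X followed by
  -- conjugation by (1, k). Its image is thus a conjugate of X.
  let j : X →* G := (MonoidHom.fst G K).comp X.subtype
  have hj : ∀ x : X, j.prod (φ.comp f) x = MulAut.conj ((1 : G), k) x := fun x =>
    Prod.ext (by simp [j]) (hk x).symm
  have hinj : Function.Injective (j.prod (φ.comp f)) := fun a b hab => by
    rw [hj, hj] at hab
    exact Subtype.ext ((MulAut.conj _).injective hab)
  have h3 := (idempotentIdeal F φ).map_mem (FinBiset.ind j) h2
  have h0 : (Nat.card (Subgroup.normalizer ((j.prod (φ.comp f)).range : Set (G × K))) : F) ≠ 0 := by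
    exact_mod_cast Nat.card_pos.ne'
  have h4 := Submodule.smul_mem _
    (Nat.card (Subgroup.normalizer ((φ.comp f).graph : Set (X × K))) : F) h3
  rw [mapBiset_ind_burnsideIdempotent_graph F j (φ.comp f) hinj, Submodule.smul_mem_iff _ h0] at h4
  refine ShiftedBurnsideIdeal.burnsideIdempotent_mem _ h4 ?_
  rw [FBurnside.mark_burnsideIdempotent_ne_zero_iff]
  refine ⟨((1 : G), k), ?_⟩
  ext p
  constructor
  · rintro ⟨x, rfl⟩
    exact ⟨x, x.2, (hj x).symm⟩
  · rintro ⟨x, hx, rfl⟩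
    exact ⟨⟨x, hx⟩, hj ⟨x, hx⟩⟩

end Ideals

theorem mainTheorem6 {F : Type v} [Field F] [CharZero F] {K : Type u} [Group K] [Finite K]
    {L : Type u} [Group L] [Finite L] (φ : L →* K) (hφ : IsRelativeBGroup φ) :
    (∀ (G : Type u) [Group G] [Finite G],
      (idempotentIdeal F φ).eval G =
        Submodule.span F {e : ShiftedBurnside F K G | ∃ X : Subgroup (G × K),
          HasQuotientOver (subgroupSnd X) φ ∧ e = burnsideIdempotent F X}) ∧
    (∀ (M : Type u) [Group M] [Finite M] (ψ : M →* K),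
      idempotentIdeal F ψ ≤ idempotentIdeal F φ ↔ HasQuotientOver ψ φ) := by
  have hmem : ∀ {M : Type u} [Group M] [Finite M] (ψ : M →* K), HasQuotientOver ψ φ →
      burnsideIdempotent F ψ.graph ∈ (idempotentIdeal F φ).eval M := fun ψ h =>
    burnsideIdempotent_mem_idempotentIdeal F ((subgroupSnd_graph_hasQuotientOver ψ).trans h)
  have hle : idempotentIdeal F φ ≤ quotientIdeal F hφ := by
    refine ShiftedBurnsideIdeal.generatedBy_le ?_
    rw [quotientIdeal_eval]
    exact Submodule.subset_span ⟨_, subgroupSnd_graph_hasQuotientOver φ, rfl⟩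
  refine ⟨fun G _ _ => le_antisymm ((hle G).trans (quotientIdeal_eval F hφ G).le) ?_,
    fun M _ _ ψ => ⟨fun h => ?_, fun h => ShiftedBurnsideIdeal.generatedBy_le (hmem ψ h)⟩⟩
  · rw [Submodule.span_le]
    rintro _ ⟨X, hX, rfl⟩
    exact burnsideIdempotent_mem_idempotentIdeal F hX
  -- The inclusion puts e_{M_ψ} into the ideal defined by marks; its mark at M_ψ ≅ M is non-zero,
  -- which gives the quotient.
  · have h1 := hle M (h M (ShiftedBurnsideIdeal.mem_generatedBy
      (burnsideIdempotent F ψ.graph : ShiftedBurnside F K M)))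
    exact (hasQuotientOver_subgroupSnd_graph ψ).trans
      (h1 _ (FBurnside.mark_burnsideIdempotent_self_ne_zero F _))
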